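/- Let $L/K$ be a finite abelian Galois extension with group $G=\mathrm{Gal}(L/K)$, and let $\theta_1,\dots,\theta_m\in G$, of orders $n_1,\dots,n_m$, be such that every element of $G$ is $\theta^{\mathbf i}=\theta_1^{i_1}\cdots\theta_m^{i_m}$ for exactly one $\mathbf i\in\Lambda(\mathbf n)=\prod_j\{0,\dots,n_j-1\}$; put $|\mathbf i|=i_1+\dots+i_m$. Let $L[G]$ be the skew group algebra. The rank $\mathrm{Rk}(A)$ of $A=\sum_{\mathbf i}a_{\mathbf i}\theta^{\mathbf i}\in L[G]$ is the rank of the $K$-endomorphism $x\mapsto\sum_{\mathbf i} a_{\mathbf i}\theta^{\mathbf i}(x)$ of $L$. For $r\ge 0$ let $\mathrm{RM}_\theta(r,\mathbf n)\subseteq L[G]$ be the $L$-subspace of all $A$ with $a_{\mathbf i}=0$ whenever $|\mathbf i|>r$, let $k$ be its $L$-dimension, let $d$ be its minimum distance (the minimum of $\mathrm{Rk}(A)$ over its nonzero elements $A$), and let $t=\lfloor (d-1)/2\rfloor$. The $G$-Dickson matrix of $A$ is the $\Lambda(\mathbf n)\times\Lambda(\mathbf n)$ matrix $\mathbf D_G(A)$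 whose $(\mathbf i,\mathbf j)$ entry is $\theta^{\mathbf j}(a_{\mathbf l})$, where $\theta^{\mathbf j}\theta^{\mathbf l}=\theta^{\mathbf i}$. Order $\Lambda(\mathbf n)$ by the reverse lexicographic order $\prec$: $\mathbf i\prec\mathbf j$ if and only if there is an $s$ with $i_s<j_s$ and $i_u=j_u$ for all $u>s$. An operation in $L$ is an addition, subtraction, multiplication or division, a use of the constant $0$ or $1$, a test for being zero, or the application of an element of $G$. An algorithm is a computation tree over these operations, and its cost on an input is the number of operations performed. Let $\omega\ge 2$ be a feasible exponent of linear algebra over $L$ with constant $c_0$: for every $n$, the product of two $n\times n$ matrices over $L$ and the reduced row echelon form of an $n\times n$ matrix over $L$ can each be computed by a computation tree that does not apply elements of $G$ and uses at most $c_0n^\omega$ operations in $L$. The constant in each $\mathcal O$ below depends only on $\omega$ and $c_0$. Let $C\in\mathrm{RM}_\theta(r,\mathbf n)$ and $Y=C+E$ with $\mathrm{Rk}(E)\le t$. Then: 1. $C$ is the only element $C'$ of $\mathrm{RM}_\theta(r,\mathbf n)$ with $\mathrm{Rk}(Y-C')\le t$. 2. For every $\mathbf w\in\Lambda(\mathbf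 n)$ with $|\mathbf w|\le r$ there is a $(t+1)\times(t+1)$ submatrix of $\mathbf D_G(E)$, at a position that does not depend on $E$, with vanishing determinant, that has an entry $\theta^{\mathbf j}(e_{\mathbf w})$ and all of whose other entries are of the form $\theta^{\mathbf l}(e_{\mathbf i})$ with $|\mathbf i|>r$ or $\mathbf w\prec\mathbf i$. 3. $C$ can be computed from $Y$ (both given by their coefficients in the basis $(\theta^{\mathbf i})$) by an algorithm that depends only on $L/K$, $\theta$ and $r$, in $\mathcal O(k\,t^\omega)$ operations in $L$. Moreover the unknown coefficients of $E$ can be recovered one at a time in decreasing reverse lexicographic order: for every $\mathbf w$ with $|\mathbf w|\le r$, the coefficient $e_{\mathbf w}$ can be computed from the coefficients $e_{\mathbf i}$ with $|\mathbf i|>r$ or $\mathbf w\prec\mathbf i$ in $\mathcal O((t+1)^\omega)$ operations in $L$. -/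

import Mathlib

universe u v

/-! ### Rank metric Reed–Muller codes in the skew group algebra -/

section Codes

variable {K : Type u} {L : Type v} [Field K] [Field L] [Algebra K L]

/-- The exponent set `Λ(n) = [0, n₁ - 1] × ⋯ × [0, n_m - 1]`. -/
abbrev ExpSet {m : ℕ} (n : Fin m → ℕ) : Type := ∀ j : Fin m, Fin (n j)

/-- The total degree `|i| = i₁ + ⋯ + i_m`. -/
def ExpSet.deg {m : ℕ} {n : Fin m → ℕ} (i : ExpSet n) : ℕ := ∑ j, (i j : ℕ)

/-- The monomial `θ^i = θ₁^{i₁} ⋯ θ_m^{i_m}` in the Galois group. -/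
def thetaPow {m : ℕ} {n : Fin m → ℕ} (θ : Fin m → Gal(L/K)) (i : ExpSet n) : Gal(L/K) :=
  (List.ofFn fun j => θ j ^ (i j : ℕ)).prod

/-- `θ₁, …, θ_m` exhibit the (abelian) Galois group as the product
`ℤ/n₁ℤ × ⋯ × ℤ/n_mℤ`: `θ_j` has order `n_j`, and every element of the group is `θ^i` for exactly
one `i ∈ Λ(n)`. -/
structure IsCyclicDecomposition {m : ℕ} (n : Fin m → ℕ) (θ : Fin m → Gal(L/K)) : Prop where
  orderOf_eq : ∀ j, orderOf (θ j) = n j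
  bijective : Function.Bijective (thetaPow θ : ExpSet n → Gal(L/K))

/-- The skew group algebra `L[G]`, with `(a g) (b h) = (a g(b)) (g h)`. -/
abbrev SkewGalAlgebra (K : Type u) (L : Type v) [Field K] [Field L] [Algebra K L] : Type v :=
  SkewMonoidAlgebra L Gal(L/K)

/-- The `K`-endomorphism `x ↦ ∑ a_g g(x)` of `L` induced by `A = ∑ a_g g`. -/
noncomputable def SkewGalAlgebra.toEnd (A : SkewGalAlgebra K L) : L →ₗ[K] L :=
  A.sum fun g a => a • g.toLinearMap

/-- The rank of an element of `L[G]`. -/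
noncomputable def SkewGalAlgebra.rk (A : SkewGalAlgebra K L) : ℕ :=
  Module.finrank K (LinearMap.range (SkewGalAlgebra.toEnd A))

/-- The minimum rank distance of an `L`-linear code in `L[G]`. -/
noncomputable def minRankDist (𝒞 : Submodule L (SkewGalAlgebra K L)) : ℕ :=
  sInf {s | ∃ A ∈ 𝒞, A ≠ 0 ∧ SkewGalAlgebra.rk A = s}

/-- The Reed–Muller code `RM_θ(r, n)`: all `θ`-polynomials of `θ`-degree at most `r`, i.e. all
monomials `θ^i` that occur have `|i| ≤ r`. -/
def rankRM {m : ℕ} (n : Fin m → ℕ) (θ : Fin m → Gal(L/K)) (r : ℕ) :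
    Submodule L (SkewGalAlgebra K L) where
  carrier := {P | ∀ i : ExpSet n, P.coeff (thetaPow θ i) ≠ 0 → i.deg ≤ r}
  add_mem' := by
    intro P Q hP hQ i hi
    by_cases h : P.coeff (thetaPow θ i) = 0
    · refine hQ i fun h' => hi ?_
      simp [h, h']
    · exact hP i h
  zero_mem' := by
    intro i hi
    simp at hi
  smul_mem' := by
    intro a P hP i hi
    refine hP i fun h => hi ?_
    simp [h]

/-- The coefficients of `A = ∑_i a_i θ^i`, indexed by `Λ(n)`. -/
noncomputable def thetaCoeff {m : ℕ} {n : Fin m → ℕ} (θ : Fin m → Gal(L/K))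
    (A : SkewGalAlgebra K L) (i : ExpSet n) : L :=
  A.coeff (thetaPow θ i)

/-- The `G`-Dickson matrix of `A`, rows and columns indexed by `Λ(n)`: the entry at `(i, j)` is
`θ^j(a_k)`, where `θ^j θ^k = θ^i`. -/
noncomputable def dicksonMatrix {m : ℕ} {n : Fin m → ℕ} (θ : Fin m → Gal(L/K))
    (A : SkewGalAlgebra K L) : Matrix (ExpSet n) (ExpSet n) L :=
  Matrix.of fun i j => thetaPow θ j (A.coeff ((thetaPow θ j)⁻¹ * thetaPow θ i))

end Codes

/-! ### Algebraic computation trees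

Algorithms over a field `F` that may use the four arithmetic operations, the constants `0` and `1`,
equality tests with `0`, and unary maps `F → F` named by the elements of a type `Γ`. Each
of these costs one operation. Values are accessed only through the addresses at which they are
stored, so that an algorithm can depend on them only through tests. -/

/-- One instruction, with operands at addresses in `V`. -/
inductive ArithOp (Γ : Type v) (V : Type) : Type v where
  | zero
  | one
  | add (a b : V)
  | sub (a b : V)
  | mul (a b : V)
  | div (a b : V)
  | app (γ : Γ) (a : V)

/-- Computation trees whose available values have addresses in `V` and whose outputs are indexed
by `O`. `ret out` stops and returns the values at the addresses `out o`; `step e T` computes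
one new value, stored at the new address `none`, and continues with `T`; `branch a T₀ T₁` continues
with `T₀` if the value at `a` is zero, and with `T₁` otherwise. -/
inductive CompTree (Γ : Type v) (O : Type) : Type → Type (max v 1) where
  | ret {V : Type} (out : O → V) : CompTree Γ O V
  | step {V : Type} (e : ArithOp Γ V) (next : CompTree Γ O (Option V)) : CompTree Γ O V
  | branch {V : Type} (a : V) (ifZero ifNonzero : CompTree Γ O V) : CompTree Γ O V

section Computation

variable {F : Type u} [Field F] {Γ : Type v}

/-- The value computed by an instruction (with the convention `x / 0 = 0`). -/
def ArithOp.eval (act : Γ → F → F) {V : Type} (x : V → F) : ArithOp Γ V → F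
  | zero => 0
  | one => 1
  | add a b => x a + x b
  | sub a b => x a - x b
  | mul a b => x a * x b
  | div a b => x a / x b
  | app γ a => act γ (x a)

open Classical in
/-- The output of a computation tree on the input `x`. -/
noncomputable def CompTree.eval (act : Γ → F → F) {O : Type} :
    {V : Type} → CompTree Γ O V → (V → F) → O → F
  | _, ret out, x => fun o => x (out o)
  | _, step e next, x => next.eval act fun a => a.elim (e.eval act x) x
  | _, branch a T₀ T₁, x => if x a = 0 then T₀.eval act x else T₁.eval act x

open Classical in
/-- The number of operations (instructions and tests) performed on the input `x`. -/
noncomputable def CompTree.cost (act : Γ → F → F) {O : Type} :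
    {V : Type} → CompTree Γ O V → (V → F) → ℕ
  | _, ret _, _ => 0
  | _, step e next, x => 1 + next.cost act fun a => a.elim (e.eval act x) x
  | _, branch a T₀ T₁, x => 1 + if x a = 0 then T₀.cost act x else T₁.cost act x

end Computation

/-- No unary maps besides the field operations. -/
def noUnary {F : Type u} : Empty → F → F := fun γ => γ.elim

/-- `ω` is a feasible exponent of linear algebra over `F`, with constant `c`: products of two
`n × n` matrices, and the reduced row echelon form of an `n × n` matrix, can be computed with at
most `c n ^ ω` arithmetic operations and tests in `F`, for every `n`. -/
def LinAlgExponent (F : Type u) [Field F] (c ω : ℝ) : Prop :=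
  (∀ n : ℕ, ∃ T : CompTree Empty (Fin n × Fin n) (Fin n × Fin n ⊕ Fin n × Fin n),
    ∀ A B : Matrix (Fin n) (Fin n) F,
      let x := Sum.elim (fun p => A p.1 p.2) (fun p => B p.1 p.2)
      (∀ i j, T.eval noUnary x (i, j) = (A * B) i j) ∧ (T.cost noUnary x : ℝ) ≤ c * (n : ℝ) ^ ω) ∧
  (∀ n : ℕ, ∃ T : CompTree Empty (Fin n × Fin n) (Fin n × Fin n),
    ∀ A : Matrix (Fin n) (Fin n) F,
      let x := fun p : Fin n × Fin n => A p.1 p.2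
      let R : Matrix (Fin n) (Fin n) F := Matrix.of fun i j => T.eval noUnary x (i, j)
      R.IsReducedRowEchelon ∧ (∃ U : Matrix (Fin n) (Fin n) F, IsUnit U ∧ R = U * A) ∧
        (T.cost noUnary x : ℝ) ≤ c * (n : ℝ) ^ ω)

/-! For `w` of degree at most `r`, let the box of `w` consist of the exponents `s` for which `w + s`
does not wrap around in any coordinate. List elements `σ_p` of the box increasingly and take from
the Dickson matrix of `E` the rows `w + σ_p` and the columns `σ_q`. The diagonal entries are the
conjugates `θ^{σ_p}(e_w)`. Since nothing wraps around, the entries strictly below the diagonal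
involve only `e_i` with `w ≺ i` (`lt_of_mul_eq_expAdd`). The matrix has rank at most `rk E ≤ t`
(`rank_dicksonMatrix_le`).

Long enough lists exist because the box has at least `d` elements (`minRankDist_le`). On the fixed
field of the `θ_k`, `k ≠ j`, choose a nonzero `θ_j`-polynomial of degree at most `w_j` vanishing at
the first `w_j` members of a spanning family of `n_j` elements. The product over `j` is a codeword
that kills all products of members except those indexed by `l ≥ w`, and these are as many as the
box. Hence there are lists of length `2t + 1 ≤ d`, and the rows from position `t` on with the
columns up to `t` give a vanishing minor with one unknown entry.

Such a minor need not determine `e_w`, as its cofactor may vanish. Instead each diagonal entry casts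
a vote for `e_w` or abstains, in such a way that abstentions plus twice the wrong votes are at most
twice the rank (`IsVote`). With `2t + 1` voters and rank at most `t`, a strict majority of the votes
cast is correct. Votes are computed by bisection (`isVote_append`): if `B` is the known lower left
block, `A₁` and `A₃` the diagonal blocks, `BZ = 0` and `Z'B = 0`, then the ranks of `B`, `A₁Z` and
`Z'A₃` add up to at most that of the whole. Row reduction gives triangular `Z`, `Z'` with diagonal
entries `0` and `1`, so `A₁Z` and `Z'A₃` are again known below the diagonal and the recursion
continues. Its cost is that of a few products and row reductions of the full size.

Running through the `w` in decreasing order recovers all unknown coefficients of `E`; uniqueness is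
the triangle inequality for the rank. -/

/-! ### Combinators for computation trees -/

namespace CompTree

variable {Γ : Type v} {O P : Type}

/-- Rename the addresses of an instruction. -/
def _root_.ArithOp.rename {V W : Type} (ρ : V → W) : ArithOp Γ V → ArithOp Γ W
  | .zero => .zero
  | .one => .one
  | .add a b => .add (ρ a) (ρ b)
  | .sub a b => .sub (ρ a) (ρ b)
  | .mul a b => .mul (ρ a) (ρ b)
  | .div a b => .div (ρ a) (ρ b)
  | .app γ a => .app γ (ρ a)

/-- Rename the addresses of a computation tree. -/
def rename : {V W : Type} → (V → W) → CompTree Γ O V → CompTree Γ O W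
  | _, _, ρ, ret out => ret (ρ ∘ out)
  | _, _, ρ, step e next => step (e.rename ρ) (next.rename (Option.map ρ))
  | _, _, ρ, branch a T₀ T₁ => branch (ρ a) (T₀.rename ρ) (T₁.rename ρ)

/-- Run `T`, then run `S` on the inputs and outputs of `T`. -/
def seq : {V : Type} → CompTree Γ O V → CompTree Γ P (V ⊕ O) → CompTree Γ P V
  | _, ret out, S => S.rename (Sum.elim id out)
  | _, step e next, S => step e (next.seq (S.rename (Sum.map some id)))
  | _, branch a T₀ T₁, S => branch a (T₀.seq S) (T₁.seq S)

/-- Regard an instruction without unary maps as an instruction with unary maps. -/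
def _root_.ArithOp.liftUnary {V : Type} : ArithOp Empty V → ArithOp Γ V
  | .zero => .zero
  | .one => .one
  | .add a b => .add a b
  | .sub a b => .sub a b
  | .mul a b => .mul a b
  | .div a b => .div a b

/-- Regard a computation tree without unary maps as a tree with unary maps. -/
def liftUnary : {V : Type} → CompTree Empty O V → CompTree Γ O V
  | _, ret out => ret out
  | _, step e next => step e.liftUnary next.liftUnary
  | _, branch a T₀ T₁ => branch a T₀.liftUnary T₁.liftUnary

variable {F : Type u} [Field F] (act : Γ → F → F)

lemma _root_.ArithOp.eval_rename {V W : Type} (ρ : V → W) (e : ArithOp Γ V) (x : W → F) :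
    (e.rename ρ).eval act x = e.eval act (x ∘ ρ) := by
  cases e <;> rfl

lemma elim_comp_optionMap {F : Type u} {V W : Type} (ρ : V → W) (y : F) (x : W → F) :
    (fun a : Option W => a.elim y x) ∘ Option.map ρ = fun a => a.elim y (x ∘ ρ) := by
  funext a; cases a <;> rfl

lemma eval_rename {V W : Type} (ρ : V → W) (T : CompTree Γ O V) (x : W → F) :
    (T.rename ρ).eval act x = T.eval act (x ∘ ρ) := by
  induction T generalizing W with
  | ret out => rfl
  | step e next ih =>
    simp only [rename, eval, ih, elim_comp_optionMap, ArithOp.eval_rename]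
  | branch a T₀ T₁ ih₀ ih₁ => simp only [rename, eval, ih₀, ih₁, Function.comp]

lemma cost_rename {V W : Type} (ρ : V → W) (T : CompTree Γ O V) (x : W → F) :
    (T.rename ρ).cost act x = T.cost act (x ∘ ρ) := by
  induction T generalizing W with
  | ret out => rfl
  | step e next ih =>
    simp only [rename, cost, ih, elim_comp_optionMap, ArithOp.eval_rename]
  | branch a T₀ T₁ ih₀ ih₁ => simp only [rename, cost, ih₀, ih₁, Function.comp]

lemma elim_comp_sumMap {F : Type u} {V : Type} (y : F) (x : V → F) (z : O → F) :
    Sum.elim (fun a : Option V => a.elim y x) z ∘ Sum.map some id = Sum.elim x z := by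
  funext a; cases a <;> rfl

lemma eval_seq {V : Type} (T : CompTree Γ O V) (S : CompTree Γ P (V ⊕ O)) (x : V → F) :
    (T.seq S).eval act x = S.eval act (Sum.elim x (T.eval act x)) := by
  induction T with
  | ret out =>
    simp only [seq, eval, eval_rename]
    congr 1
    funext a; cases a <;> rfl
  | step e next ih => simp only [seq, eval, ih, eval_rename, elim_comp_sumMap]
  | branch a T₀ T₁ ih₀ ih₁ =>
    simp only [seq, eval, ih₀, ih₁]
    split_ifs <;> rfl

lemma cost_seq {V : Type} (T : CompTree Γ O V) (S : CompTree Γ P (V ⊕ O)) (x : V → F) :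
    (T.seq S).cost act x = T.cost act x + S.cost act (Sum.elim x (T.eval act x)) := by
  induction T with
  | ret out =>
    simp only [seq, cost, eval, cost_rename, zero_add]
    congr 1
    funext a; cases a <;> rfl
  | step e next ih => simp only [seq, cost, eval, ih, cost_rename, elim_comp_sumMap, add_assoc]
  | branch a T₀ T₁ ih₀ ih₁ =>
    simp only [seq, cost, eval, ih₀, ih₁]
    split_ifs <;> ring

lemma _root_.ArithOp.eval_liftUnary {V : Type} (e : ArithOp Empty V) (x : V → F) :
    (e.liftUnary (Γ := Γ)).eval act x = e.eval noUnary x := by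
  cases e with
  | app γ a => exact γ.elim
  | _ => rfl

lemma eval_liftUnary {V : Type} (T : CompTree Empty O V) (x : V → F) :
    (T.liftUnary (Γ := Γ)).eval act x = T.eval noUnary x := by
  induction T with
  | ret out => rfl
  | step e next ih => simp only [liftUnary, eval, ih, ArithOp.eval_liftUnary]
  | branch a T₀ T₁ ih₀ ih₁ => simp only [liftUnary, eval, ih₀, ih₁]

lemma cost_liftUnary {V : Type} (T : CompTree Empty O V) (x : V → F) :
    (T.liftUnary (Γ := Γ)).cost act x = T.cost noUnary x := by
  induction T with
  | ret out => rfl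
  | step e next ih => simp only [liftUnary, cost, ih, ArithOp.eval_liftUnary]
  | branch a T₀ T₁ ih₀ ih₁ => simp only [liftUnary, cost, ih₀, ih₁]

end CompTree

/-- The function `f` can be computed by a computation tree of worst-case cost at most `b`. -/
def TreeComputable {Γ : Type v} {F : Type u} [Field F] (act : Γ → F → F) {V O : Type} (b : ℝ)
    (f : (V → F) → O → F) : Prop :=
  ∃ T : CompTree Γ O V, ∀ x, T.eval act x = f x ∧ (T.cost act x : ℝ) ≤ b

/-! ### Cost calculus for functions computed by trees. -/

namespace TreeComputable

variable {Γ : Type v} {F : Type u} [Field F] {act : Γ → F → F} {V W O P : Type} {b b' : ℝ}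

lemma mono {f : (V → F) → O → F} (h : TreeComputable act b f) (hb : b ≤ b') :
    TreeComputable act b' f := by
  obtain ⟨T, hT⟩ := h
  exact ⟨T, fun x => ⟨(hT x).1, (hT x).2.trans hb⟩⟩

lemma select (out : O → V) : TreeComputable act 0 (fun (x : V → F) o => x (out o)) :=
  ⟨.ret out, fun x => ⟨rfl, by simp [CompTree.cost]⟩⟩

lemma op (e : ArithOp Γ V) : TreeComputable act 1 (fun (x : V → F) (_ : O) => e.eval act x) :=
  ⟨.step e (.ret fun _ => none), fun x => ⟨rfl, by simp [CompTree.cost]⟩⟩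

lemma bind {f : (V → F) → O → F} {g : (V ⊕ O → F) → P → F} (hf : TreeComputable act b f)
    (hg : TreeComputable act b' g) :
    TreeComputable act (b + b') (fun x => g (Sum.elim x (f x))) := by
  obtain ⟨T, hT⟩ := hf
  obtain ⟨S, hS⟩ := hg
  refine ⟨T.seq S, fun x => ⟨?_, ?_⟩⟩
  · rw [CompTree.eval_seq, (hT x).1, (hS _).1]
  · rw [CompTree.cost_seq, Nat.cast_add]
    exact add_le_add (hT x).2 (hS _).2

lemma precomp {f : (V → F) → O → F} (hf : TreeComputable act b f) (ρ : V → W) :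
    TreeComputable act b (fun x => f (x ∘ ρ)) := by
  obtain ⟨T, hT⟩ := hf
  exact ⟨T.rename ρ, fun x => ⟨by rw [CompTree.eval_rename, (hT _).1],
    by rw [CompTree.cost_rename]; exact (hT _).2⟩⟩

lemma comp {f : (V → F) → O → F} {g : (O → F) → P → F} (hf : TreeComputable act b f)
    (hg : TreeComputable act b' g) : TreeComputable act (b + b') (fun x => g (f x)) :=
  hf.bind (hg.precomp Sum.inr)

lemma postcomp {f : (V → F) → O → F} (hf : TreeComputable act b f) (ρ : P → O) :
    TreeComputable act b (fun x p => f x (ρ p)) := by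
  simpa using hf.comp (select ρ)

lemma pair {f : (V → F) → O → F} {g : (V → F) → P → F} (hf : TreeComputable act b f)
    (hg : TreeComputable act b' g) :
    TreeComputable act (b + b') (fun x => Sum.elim (f x) (g x)) := by
  have h := hf.bind ((hg.precomp (Sum.inl : V → V ⊕ O)).bind
    (select (Sum.elim (Sum.inl ∘ Sum.inr) Sum.inr : O ⊕ P → (V ⊕ O) ⊕ P)))
  rw [add_zero] at h
  convert h using 3 with x o
  cases o <;> rfl

lemma congr {f g : (V → F) → O → F} (hf : TreeComputable act b f) (h : ∀ x o, f x o = g x o) :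
    TreeComputable act b g := by
  have : f = g := by funext x o; exact h x o
  exact this ▸ hf

/-- Compute a family of values one after another. -/
lemma family [Fintype O] {f : (V → F) → O → F}
    (h : ∀ o, TreeComputable act b (fun x (_ : Unit) => f x o)) :
    TreeComputable act (Fintype.card O * b) f := by
  revert f
  suffices H : ∀ f : (V → F) → O → F, (∀ o, TreeComputable act b (fun x (_ : Unit) => f x o)) →
      TreeComputable act (Fintype.card O * b) f from fun {f} => H f
  refine Fintype.induction_empty_option (P := fun O _ => ∀ f : (V → F) → O → F,
    (∀ o, TreeComputable act b (fun x (_ : Unit) => f x o)) →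
      TreeComputable act (Fintype.card O * b) f) ?_ ?_ ?_ O
  · intro α β _ e ih f h
    let _ := Fintype.ofEquiv β e.symm
    have := (ih (fun x a => f x (e a)) fun a => h (e a)).postcomp e.symm
    rw [← Fintype.card_congr e]
    convert this using 3
    rw [e.apply_symm_apply]
  · intro f _
    refine ⟨.ret PEmpty.elim, fun x => ⟨funext fun o => o.elim, by simp [CompTree.cost]⟩⟩
  · intro α _ ih f h
    have := ((ih (fun x a => f x (some a)) fun a => h (some a)).pair (h none)).postcomp
      (fun o : Option α => o.elim (Sum.inr ()) Sum.inl)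
    rw [Fintype.card_option]
    refine (this.congr ?_).mono ?_
    · intro x o; cases o <;> rfl
    · push_cast; linarith

/-- Test the values at the addresses `τ q` and continue according to the set of zeros. -/
lemma testAll {Q : Type} [Fintype Q] (τ : Q → V) {g : Set Q → (V → F) → O → F}
    (h : ∀ s, TreeComputable act b (g s)) :
    TreeComputable act (b + Fintype.card Q) (fun x => g {q | x (τ q) = 0} x) := by
  classical
  revert g τ
  refine Fintype.induction_empty_option (P := fun Q _ => ∀ (τ : Q → V)
    (g : Set Q → (V → F) → O → F), (∀ s, TreeComputable act b (g s)) →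
      TreeComputable act (b + Fintype.card Q) (fun x => g {q | x (τ q) = 0} x)) ?_ ?_ ?_ Q
  · intro α β _ e ih τ g h
    let _ := Fintype.ofEquiv β e.symm
    have := ih (τ ∘ e) (fun s => g (e.symm ⁻¹' s)) fun s => h _
    rw [← Fintype.card_congr e]
    convert this using 3
    ext b
    simp
  · intro τ g h
    refine ((h ∅).congr fun x o => ?_).mono (by simp)
    rw [Set.eq_empty_of_isEmpty {q : PEmpty | x (τ q) = 0}]
  · intro α _ ih τ g h
    obtain ⟨T₀, h₀⟩ := ih (τ ∘ some) (fun s => g (insert none (some '' s))) fun s => h _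
    obtain ⟨T₁, h₁⟩ := ih (τ ∘ some) (fun s => g (some '' s)) fun s => h _
    refine ⟨.branch (τ none) T₀ T₁, fun x => ?_⟩
    rw [Fintype.card_option]
    by_cases hx : x (τ none) = 0
    · simp only [CompTree.eval, CompTree.cost, if_pos hx]
      refine ⟨?_, by push_cast; linarith [(h₀ x).2]⟩
      rw [(h₀ x).1]
      refine congrArg (g · x) (Set.ext fun q => ?_)
      cases q <;> simp [hx]
    · simp only [CompTree.eval, CompTree.cost, if_neg hx]
      refine ⟨?_, by push_cast; linarith [(h₁ x).2]⟩
      rw [(h₁ x).1]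
      refine congrArg (g · x) (Set.ext fun q => ?_)
      cases q <;> simp [hx]

/-- Entrywise subtraction. -/
lemma sub [Fintype O] {f g : (V → F) → O → F} (hf : TreeComputable act b f)
    (hg : TreeComputable act b' g) :
    TreeComputable act (b + b' + Fintype.card O) (fun x o => f x o - g x o) := by
  have h : TreeComputable act (Fintype.card O * 1)
      (fun (y : O ⊕ O → F) o => y (Sum.inl o) - y (Sum.inr o)) :=
    family fun o => op (.sub (Sum.inl o) (Sum.inr o))
  simpa using (hf.pair hg).comp h

/-- Entrywise multiplication. -/
lemma mul [Fintype O] {f g : (V → F) → O → F} (hf : TreeComputable act b f)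
    (hg : TreeComputable act b' g) :
    TreeComputable act (b + b' + Fintype.card O) (fun x o => f x o * g x o) := by
  have h : TreeComputable act (Fintype.card O * 1)
      (fun (y : O ⊕ O → F) o => y (Sum.inl o) * y (Sum.inr o)) :=
    family fun o => op (.mul (Sum.inl o) (Sum.inr o))
  simpa using (hf.pair hg).comp h

/-- Entrywise application of unary maps. -/
lemma app [Fintype O] {f : (V → F) → O → F} (hf : TreeComputable act b f) (γ : O → Γ) :
    TreeComputable act (b + Fintype.card O) (fun x o => act (γ o) (f x o)) := by
  have h : TreeComputable act (Fintype.card O * 1) (fun (y : O → F) o => act (γ o) (y o)) :=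
    family fun o => op (.app (γ o) o)
  simpa using hf.comp h

/-- Loading a vector of zeros and ones. -/
lemma indicator [Fintype O] (p : O → Prop) [DecidablePred p] :
    TreeComputable act (Fintype.card O) (fun (_ : V → F) o => if p o then (1 : F) else 0) := by
  have h : TreeComputable act (Fintype.card O * 1)
      (fun (_ : V → F) o => if p o then (1 : F) else 0) := by
    refine family fun o => ?_
    by_cases ho : p o
    · simpa [ho, ArithOp.eval] using op (act := act) (O := Unit) (V := V) .one
    · simpa [ho, ArithOp.eval] using op (act := act) (O := Unit) (V := V) .zero
  simpa using h

end TreeComputable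

/-! ### Linear algebra for the voting procedure -/

namespace Submodule

lemma finrank_add_finrank_map_le {F V W : Type*} [Field F] [AddCommGroup V] [Module F V]
    [AddCommGroup W] [Module F W] [FiniteDimensional F V] (g : V →ₗ[F] W) {S R : Submodule F V}
    (hSR : S ≤ R) (hS : S ≤ LinearMap.ker g) :
    Module.finrank F S + Module.finrank F (R.map g) ≤ Module.finrank F R := by
  have h := LinearMap.finrank_range_add_finrank_ker (g.domRestrict R)
  have h1 : LinearMap.range (g.domRestrict R) = R.map g := by
    rw [LinearMap.range_domRestrict]
  have h2 : Module.finrank F S ≤ Module.finrank F (LinearMap.ker (g.domRestrict R)) := by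
    rw [← Submodule.finrank_map_subtype_eq R (LinearMap.ker (g.domRestrict R))]
    refine Submodule.finrank_mono fun x hx => ?_
    exact ⟨⟨x, hSR hx⟩, by simpa using hS hx, rfl⟩
  rw [h1] at h
  omega

end Submodule

namespace Matrix

variable {F : Type u} [Field F]

/-- Filter the column space of the block matrix. Vectors `(Zy, 0)` produce columns `(A₁Zy, 0)`,
which the projection to the lower half kills. The projected space contains the range of `B`, which
`Z'` kills, and its image under `Z'` still contains the range of `Z'A₃`. -/
lemma rank_add_rank_mul_add_rank_mul_le {m n : Type*} [Fintype m] [Fintype n] [DecidableEq m]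
    [DecidableEq n]
    (A₁ : Matrix m m F) (A₂ : Matrix m n F) (B : Matrix n m F) (A₃ : Matrix n n F)
    (Z : Matrix m m F) (Z' : Matrix n n F) (hZ : B * Z = 0) (hZ' : Z' * B = 0) :
    B.rank + (A₁ * Z).rank + (Z' * A₃).rank ≤ (fromBlocks A₁ A₂ B A₃).rank := by
  let M := fromBlocks A₁ A₂ B A₃
  let bot : (m ⊕ n → F) →ₗ[F] (n → F) := LinearMap.funLeft F F Sum.inr
  let top : (m → F) →ₗ[F] (m ⊕ n → F) := LinearMap.pi fun s =>
    s.elim (fun i => LinearMap.proj i) fun _ => 0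
  have htop : ∀ y, top y = Sum.elim y 0 := by
    intro y; funext s; cases s <;> simp [top]
  have htop_inj : Function.Injective top := by
    intro y z h
    funext i
    simpa [htop] using congrFun h (Sum.inl i)
  have hMl : ∀ y, M *ᵥ Sum.elim y 0 = Sum.elim (A₁ *ᵥ y) (B *ᵥ y) := by
    intro y; simp [M, fromBlocks_mulVec]
  have hMr : ∀ y, M *ᵥ Sum.elim 0 y = Sum.elim (A₂ *ᵥ y) (A₃ *ᵥ y) := by
    intro y; simp [M, fromBlocks_mulVec]
  have h1 := Submodule.finrank_add_finrank_map_le bot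
    (S := (LinearMap.range (A₁ * Z).mulVecLin).map top) (R := LinearMap.range M.mulVecLin)
    (by
      rintro _ ⟨_, ⟨y, rfl⟩, rfl⟩
      refine ⟨Sum.elim (Z *ᵥ y) 0, ?_⟩
      rw [mulVecLin_apply, hMl, htop, mulVecLin_apply, mulVec_mulVec, mulVec_mulVec, hZ,
        zero_mulVec])
    (by
      rintro _ ⟨_, ⟨y, rfl⟩, rfl⟩
      rw [LinearMap.mem_ker, htop]
      rfl)
  rw [← (Submodule.equivMapOfInjective top htop_inj _).finrank_eq] at h1
  have h2 := Submodule.finrank_add_finrank_map_le Z'.mulVecLin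
    (S := LinearMap.range B.mulVecLin) (R := (LinearMap.range M.mulVecLin).map bot)
    (by
      rintro _ ⟨y, rfl⟩
      refine ⟨_, ⟨Sum.elim y 0, rfl⟩, ?_⟩
      rw [mulVecLin_apply, hMl]
      rfl)
    (by
      rintro _ ⟨y, rfl⟩
      rw [LinearMap.mem_ker, mulVecLin_apply, mulVecLin_apply, mulVec_mulVec, hZ', zero_mulVec])
  have h3 : LinearMap.range (Z' * A₃).mulVecLin ≤
      ((LinearMap.range M.mulVecLin).map bot).map Z'.mulVecLin := by
    rintro _ ⟨y, rfl⟩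
    refine ⟨_, ⟨_, ⟨Sum.elim 0 y, rfl⟩, rfl⟩, ?_⟩
    rw [mulVecLin_apply, mulVecLin_apply, hMr, mulVecLin_apply, ← mulVec_mulVec]
    rfl
  have h4 := Submodule.finrank_mono h3
  change _ ≤ Module.finrank F (LinearMap.range M.mulVecLin)
  simp only [Matrix.rank]
  omega

/-- Upper triangular matrices with diagonal entries `0` and `1`, at most `ρ` of them `0`. -/
structure IsTriangularProjector {n : ℕ} (Z : Matrix (Fin n) (Fin n) F) (ρ : ℕ) : Prop where
  upper : ∀ i j, j < i → Z i j = 0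
  diag : ∀ i, Z i i = 0 ∨ Z i i = 1
  card_le : {i | Z i i = 0}.ncard ≤ ρ

open Classical in
/-- The positions of the leading entries, as a matrix of zeros and ones. -/
noncomputable def leadMatrix {n : ℕ} (R : Matrix (Fin n) (Fin n) F) : Matrix (Fin n) (Fin n) F :=
  of fun i q => if R.IsLeadingEntry i q then 1 else 0

/-! ### Triangular annihilators from the reduced row echelon form. -/

section RowEchelon

variable {n : ℕ} {R : Matrix (Fin n) (Fin n) F}

/-- Multiplying by the transposed lead matrix on the left moves each nonzero row of `R` to the
height of its pivot column, making the result upper triangular with ones exactly at the pivots of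
the diagonal. The pivot columns of `R` are unit vectors, so multiplying by `R` moves the rows back.
-/
lemma mul_leadMatrix_transpose_mul (hR : R.IsReducedRowEchelon) :
    R * ((leadMatrix R)ᵀ * R) = R := by
  classical
  ext k p
  rw [← Matrix.mul_assoc, mul_apply]
  have key : ∀ i, (R * (leadMatrix R)ᵀ) k i * R i p = if i = k then R i p else 0 := by
    intro i
    by_cases hi : R i = 0
    · simp [hi]
    · obtain ⟨c, hc⟩ := row_ne_zero_iff_exists_isLeadingEntry.1 hi
      have : (R * (leadMatrix R)ᵀ) k i = R k c := by
        rw [mul_apply, Finset.sum_eq_single c]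
        · simp [leadMatrix, hc]
        · intro q _ hq
          have : ¬ R.IsLeadingEntry i q := fun h => hq (h.unique hc)
          simp [leadMatrix, this]
        · simp
      rw [this]
      split_ifs with h
      · subst h; rw [hR.eq_one hc, one_mul]
      · rw [hR.eq_zero_of_ne_of_isLeadingEntry (Ne.symm h) hc, zero_mul]
  simp [key]

lemma leadMatrix_transpose_mul_apply_of_lt {q p : Fin n} (h : p < q) :
    ((leadMatrix R)ᵀ * R) q p = 0 := by
  classical
  rw [mul_apply]
  refine Finset.sum_eq_zero fun i _ => ?_
  by_cases hi : R.IsLeadingEntry i q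
  · simp [hi.1 p h]
  · simp [leadMatrix, hi]

lemma leadMatrix_transpose_mul_apply_self (hR : R.IsReducedRowEchelon) (p : Fin n) :
    ((∃ i, R.IsLeadingEntry i p) ∧ ((leadMatrix R)ᵀ * R) p p = 1) ∨
      (¬ (∃ i, R.IsLeadingEntry i p) ∧ ((leadMatrix R)ᵀ * R) p p = 0) := by
  classical
  rw [mul_apply]
  by_cases h : ∃ i, R.IsLeadingEntry i p
  · left
    refine ⟨h, ?_⟩
    obtain ⟨i, hi⟩ := h
    rw [Finset.sum_eq_single i]
    · simp [leadMatrix, hi, hR.eq_one hi]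
    · intro k _ hk
      rw [hR.eq_zero_of_ne_of_isLeadingEntry hk hi, mul_zero]
    · simp
  · right
    refine ⟨h, Finset.sum_eq_zero fun i _ => ?_⟩
    have : ¬ R.IsLeadingEntry i p := fun hi => h ⟨i, hi⟩
    simp [leadMatrix, this]

lemma ncard_exists_isLeadingEntry_le_rank (hR : R.IsReducedRowEchelon) :
    {p | ∃ i, R.IsLeadingEntry i p}.ncard ≤ R.rank := by
  classical
  let l : Fin n → WithTop (Fin n) := fun i =>
    if h : ∃ c, R.IsLeadingEntry i c then (h.choose : WithTop (Fin n)) else ⊤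
  have hl : ∀ i (c : Fin n), l i = c → R.IsLeadingEntry i c := by
    intro i c h
    by_cases hc : ∃ c, R.IsLeadingEntry i c
    · simp only [l, dif_pos hc, WithTop.coe_inj] at h
      exact h ▸ hc.choose_spec
    · simp [l, dif_neg hc] at h
  have hP : R.IsPivotedBy l := by
    refine ⟨hR.isRowEchelon, fun i => ⟨fun j hj => ?_, fun c hc => (hl i c hc).2⟩⟩
    by_cases hc : ∃ c, R.IsLeadingEntry i c
    · simp only [l, dif_pos hc, WithTop.coe_lt_coe] at hj
      exact hc.choose_spec.1 j hj
    · by_contra hne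
      exact hc (row_ne_zero_iff_exists_isLeadingEntry.1 fun h => hne (congrFun h j))
  rw [hP.rank_eq, ← Set.ncard_coe_finset]
  have : {p | ∃ i, R.IsLeadingEntry i p} ⊆
      (fun i => (l i).untopD i) ''
        ((Finset.univ.filter fun i => l i ≠ ⊤ : Finset (Fin n)) : Set (Fin n)) := by
    rintro p ⟨i, hi⟩
    have hc : ∃ c, R.IsLeadingEntry i c := ⟨p, hi⟩
    refine ⟨i, ?_, ?_⟩
    · simp [l, hc]
    · simp only [l, dif_pos hc, WithTop.untopD_coe]
      exact hc.choose_spec.unique hi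
  exact (Set.ncard_le_ncard this (Set.toFinite _)).trans (Set.ncard_image_le (Set.toFinite _))

/-- The reduced row echelon form yields a triangular matrix annihilated by the given one. -/
lemma isTriangularProjector_of_isReducedRowEchelon (hR : R.IsReducedRowEchelon) :
    IsTriangularProjector (1 - (leadMatrix R)ᵀ * R) R.rank where
  upper i j h := by
    rw [sub_apply, leadMatrix_transpose_mul_apply_of_lt h, one_apply_ne h.ne', sub_zero]
  diag i := by
    rw [sub_apply, one_apply_eq]
    rcases leadMatrix_transpose_mul_apply_self hR i with h | h <;> simp [h.2]
  card_le := by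
    refine (Set.ncard_le_ncard (fun p hp => ?_) (Set.toFinite _)).trans
      (ncard_exists_isLeadingEntry_le_rank hR)
    rcases leadMatrix_transpose_mul_apply_self hR p with h | h
    · exact h.1
    · simp [h.2] at hp

lemma mul_one_sub_leadMatrix_eq_zero {B U : Matrix (Fin n) (Fin n) F} (hR : R.IsReducedRowEchelon)
    (hU : IsUnit U) (h : R = U * B) : B * (1 - (leadMatrix R)ᵀ * R) = 0 := by
  refine hU.mul_left_cancel ?_
  rw [mul_zero, ← Matrix.mul_assoc, ← h, Matrix.mul_sub, mul_one, mul_leadMatrix_transpose_mul hR,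
    sub_self]

end RowEchelon

/-- Reflection of a matrix along the antidiagonal. -/
def antiTranspose {F : Type u} {n : ℕ} (B : Matrix (Fin n) (Fin n) F) : Matrix (Fin n) (Fin n) F :=
  of fun i j => B j.rev i.rev

lemma antiTranspose_antiTranspose {F : Type u} {n : ℕ} (B : Matrix (Fin n) (Fin n) F) :
    antiTranspose (antiTranspose B) = B := by
  ext i j
  simp [antiTranspose]

/-- Unlike the transpose, this reflection reverses products while keeping upper triangular matrices
upper triangular, so it turns right annihilators into left ones. -/
lemma antiTranspose_mul {n : ℕ} (A B : Matrix (Fin n) (Fin n) F) :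
    antiTranspose (A * B) = antiTranspose B * antiTranspose A := by
  ext i j
  simp only [antiTranspose, of_apply, mul_apply]
  rw [← Equiv.sum_comp Fin.revPerm]
  exact Finset.sum_congr rfl fun k _ => by simp [mul_comm]

lemma rank_antiTranspose {n : ℕ} (B : Matrix (Fin n) (Fin n) F) :
    (antiTranspose B).rank = B.rank := by
  have : antiTranspose B = Bᵀ.submatrix Fin.revPerm Fin.revPerm := by
    ext i j; rfl
  rw [this, rank_submatrix, rank_transpose]

lemma IsTriangularProjector.antiTranspose {n ρ : ℕ} {Z : Matrix (Fin n) (Fin n) F}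
    (h : IsTriangularProjector Z ρ) : IsTriangularProjector (antiTranspose Z) ρ where
  upper i j hij := h.upper _ _ (Fin.rev_lt_rev.2 hij)
  diag i := h.diag _
  card_le := by
    refine le_of_eq_of_le ?_ h.card_le
    rw [← Set.ncard_image_of_injective {i | Z i i = 0} Fin.rev_injective]
    congr 1
    ext i
    simp only [Matrix.antiTranspose, of_apply, Set.mem_ofPred_eq, Set.mem_image]
    exact ⟨fun hi => ⟨_, hi, Fin.rev_rev i⟩, by rintro ⟨j, hj, rfl⟩; simpa using hj⟩

/-- The pairs `(μ p, N p p - ν p)` are votes on the diagonal entries of any low-rank completion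
`A` of the strictly lower triangular part of `N`; the vote at `p` is void if `μ p = 0`. -/
def IsVote {n : ℕ} (N : Matrix (Fin n) (Fin n) F) (μ ν : Fin n → F) : Prop :=
  ∀ A : Matrix (Fin n) (Fin n) F, (∀ i j, j < i → A i j = N i j) →
    {p | μ p = 0}.ncard + 2 * {p | μ p ≠ 0 ∧ A p p ≠ N p p - ν p}.ncard ≤ 2 * A.rank

/-- The vote is for `0`. It is wrong only if `A ≠ 0`, and then the rank `1` pays for it. -/
lemma isVote_one (N : Matrix (Fin 1) (Fin 1) F) : IsVote N (fun _ => 1) (fun p => N p p) := by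
  intro A _
  by_cases h : A = 0
  · subst h; simp
  · have h0 : A.rank ≠ 0 := by
      intro h0
      apply h
      have h1 : LinearMap.range A.mulVecLin = ⊥ := Submodule.finrank_eq_zero.1 h0
      rw [LinearMap.range_eq_bot] at h1
      have := congrArg LinearMap.toMatrix' h1
      rwa [← Matrix.toLin'_apply', LinearMap.toMatrix'_toLin', map_zero] at this
    have h1 : {p : Fin 1 | (1 : F) ≠ 0 ∧ A p p ≠ N p p - N p p}.ncard ≤ 1 :=
      (Set.ncard_le_card _).trans (by simp)
    have h2 : {p : Fin 1 | (1 : F) = 0}.ncard = 0 := by simp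
    change {p : Fin 1 | (1 : F) = 0}.ncard +
      2 * {p : Fin 1 | (1 : F) ≠ 0 ∧ A p p ≠ N p p - N p p}.ncard ≤ _
    omega

/-! ### Combining the votes of the two halves. -/

section Split

variable {n : ℕ}

lemma ncard_le_of_append (p : Fin (n + n) → Prop) :
    {i | p i}.ncard ≤ {i | p (Fin.castAdd n i)}.ncard + {i | p (Fin.natAdd n i)}.ncard := by
  have : {i | p i} ⊆ Fin.castAdd n '' {i | p (Fin.castAdd n i)} ∪
      Fin.natAdd n '' {i | p (Fin.natAdd n i)} := by
    intro i
    refine Fin.addCases (fun j hj => Or.inl ⟨j, hj, rfl⟩) (fun j hj => Or.inr ⟨j, hj, rfl⟩) i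
  refine (Set.ncard_le_ncard this (Set.toFinite _)).trans ((Set.ncard_union_le _ _).trans ?_)
  exact add_le_add (Set.ncard_image_le (Set.toFinite _)) (Set.ncard_image_le (Set.toFinite _))

/-- Voiding the votes at the zeros of the diagonal of `Z` adds at most `ρ` abstentions; the
surviving votes stand where `Z` has diagonal entry `1`. -/
lemma ncard_vote_le {ρ : ℕ} {Z : Matrix (Fin n) (Fin n) F} (hZ : IsTriangularProjector Z ρ)
    (μ : Fin n → F) {q q' : Fin n → Prop} (hq : ∀ p, Z p p = 1 → q p → q' p) :
    {p | μ p * Z p p = 0}.ncard + 2 * {p | μ p * Z p p ≠ 0 ∧ q p}.ncard ≤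
      ρ + ({p | μ p = 0}.ncard + 2 * {p | μ p ≠ 0 ∧ q' p}.ncard) := by
  have h1 : {p | μ p * Z p p = 0} ⊆ {p | μ p = 0} ∪ {p | Z p p = 0} := by
    intro p hp
    simpa using hp
  have h2 : {p | μ p * Z p p ≠ 0 ∧ q p} ⊆ {p | μ p ≠ 0 ∧ q' p} := by
    rintro p ⟨hp, hp'⟩
    rcases hZ.diag p with h | h
    · simp [h] at hp
    · exact ⟨left_ne_zero_of_mul hp, hq p h hp'⟩
  have h3 := (Set.ncard_le_ncard h1 (Set.toFinite _)).trans (Set.ncard_union_le _ _)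
  have h4 := Set.ncard_le_ncard h2 (Set.toFinite _)
  have h5 := hZ.card_le
  omega

/-- `A - N` vanishes strictly below the diagonal and `Z` is upper triangular, so on and below the
diagonal a single term of the product survives. Below it, `AZ` is therefore known; on it, a diagonal
entry `1` of `Z` preserves the deviation from `N`, which is why votes are stored as offsets from `N
p p`. -/
lemma mul_projector_apply {A N Z : Matrix (Fin n) (Fin n) F} {ρ : ℕ}
    (hZ : IsTriangularProjector Z ρ) (hA : ∀ i j, j < i → A i j = N i j) {i j : Fin n}
    (hij : j ≤ i) : (A * Z) i j - (N * Z) i j = (A i j - N i j) * Z j j := by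
  rw [← sub_apply, ← Matrix.sub_mul, mul_apply, Finset.sum_eq_single j]
  · rw [sub_apply]
  · intro k _ hk
    rcases hk.lt_or_gt with h | h
    · rw [sub_apply, hA i k (h.trans_le hij), sub_self, zero_mul]
    · rw [hZ.upper k j h, mul_zero]
  · simp

lemma projector_mul_apply {A N Z : Matrix (Fin n) (Fin n) F} {ρ : ℕ}
    (hZ : IsTriangularProjector Z ρ) (hA : ∀ i j, j < i → A i j = N i j) {i j : Fin n}
    (hij : j ≤ i) : (Z * A) i j - (Z * N) i j = Z i i * (A i j - N i j) := by
  rw [← sub_apply, ← Matrix.mul_sub, mul_apply, Finset.sum_eq_single i]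
  · rw [sub_apply]
  · intro k _ hk
    rcases hk.lt_or_gt with h | h
    · rw [hZ.upper i k h, zero_mul]
    · rw [sub_apply, hA k j (hij.trans_lt h), sub_self, mul_zero]
  · simp

/-- The voting procedure on a matrix from those on its two triangular halves. -/
lemma isVote_append (N : Matrix (Fin (n + n)) (Fin (n + n)) F) {Z Z' : Matrix (Fin n) (Fin n) F}
    {μ ν μ' ν' : Fin n → F}
    (hZ : IsTriangularProjector Z (N.submatrix (Fin.natAdd n) (Fin.castAdd n)).rank)
    (hZ' : IsTriangularProjector Z' (N.submatrix (Fin.natAdd n) (Fin.castAdd n)).rank)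
    (hBZ : N.submatrix (Fin.natAdd n) (Fin.castAdd n) * Z = 0)
    (hZB : Z' * N.submatrix (Fin.natAdd n) (Fin.castAdd n) = 0)
    (h : IsVote (N.submatrix (Fin.castAdd n) (Fin.castAdd n) * Z) μ ν)
    (h' : IsVote (Z' * N.submatrix (Fin.natAdd n) (Fin.natAdd n)) μ' ν') :
    IsVote N (Fin.append (fun p => μ p * Z p p) (fun p => μ' p * Z' p p))
      (Fin.append ν ν') := by
  intro A hA
  let c : Fin n → Fin (n + n) := Fin.castAdd n
  let d : Fin n → Fin (n + n) := Fin.natAdd n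
  have hcc : ∀ i j, j < i → A (c i) (c j) = N (c i) (c j) := fun i j hij =>
    hA _ _ (Fin.lt_def.2 (Fin.lt_def.1 hij))
  have hdd : ∀ i j, j < i → A (d i) (d j) = N (d i) (d j) := fun i j hij =>
    hA _ _ (by simpa [d] using hij)
  have hdc : A.submatrix d c = N.submatrix d c := by
    ext i j
    exact hA _ _ (by rw [Fin.lt_def]; simp only [c, d, Fin.val_castAdd, Fin.val_natAdd]; omega)
  have h1 := h (A.submatrix c c * Z) fun i j hij => by
    have := mul_projector_apply (A := A.submatrix c c) (N := N.submatrix c c) hZ hcc hij.le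
    rw [submatrix_apply, submatrix_apply, hcc i j hij, sub_self, zero_mul] at this
    exact sub_eq_zero.1 this
  have h2 := h' (Z' * A.submatrix d d) fun i j hij => by
    have := projector_mul_apply (A := A.submatrix d d) (N := N.submatrix d d) hZ' hdd hij.le
    rw [submatrix_apply, submatrix_apply, hdd i j hij, sub_self, mul_zero] at this
    exact sub_eq_zero.1 this
  have hrank := rank_add_rank_mul_add_rank_mul_le (A.submatrix c c) (A.submatrix c d)
    (N.submatrix d c) (A.submatrix d d) Z Z' hBZ hZB
  have hblocks : fromBlocks (A.submatrix c c) (A.submatrix c d) (N.submatrix d c)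
      (A.submatrix d d) = A.submatrix finSumFinEquiv finSumFinEquiv := by
    rw [← hdc]
    ext (i | i) (j | j) <;> rfl
  rw [hblocks, rank_submatrix] at hrank
  have h3 := ncard_vote_le hZ μ (q := fun p => A (c p) (c p) ≠ N (c p) (c p) - ν p)
    (q' := fun p => (A.submatrix c c * Z) p p ≠ (N.submatrix c c * Z) p p - ν p) fun p hp hq => by
      have := mul_projector_apply (A := A.submatrix c c) (N := N.submatrix c c) hZ hcc (le_refl p)
      rw [hp, mul_one, submatrix_apply, submatrix_apply] at this
      intro h0
      apply hq
      linear_combination h0 - this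
  have h4 := ncard_vote_le hZ' μ' (q := fun p => A (d p) (d p) ≠ N (d p) (d p) - ν' p)
    (q' := fun p => (Z' * A.submatrix d d) p p ≠ (Z' * N.submatrix d d) p p - ν' p)
    fun p hp hq => by
      have := projector_mul_apply (A := A.submatrix d d) (N := N.submatrix d d) hZ' hdd (le_refl p)
      rw [hp, one_mul, submatrix_apply, submatrix_apply] at this
      intro h0
      apply hq
      linear_combination h0 - this
  have h5 := ncard_le_of_append fun p =>
    Fin.append (fun p => μ p * Z p p) (fun p => μ' p * Z' p p) p = 0
  have h6 := ncard_le_of_append fun p =>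
    Fin.append (fun p => μ p * Z p p) (fun p => μ' p * Z' p p) p ≠ 0 ∧
      A p p ≠ N p p - Fin.append ν ν' p
  simp only [Fin.append_left, Fin.append_right] at h5 h6
  simp only [c, d] at *
  -- Each half contributes at most `rank B` new abstentions, in total `2 * rank B`, which is the
  -- share of `B` in twice the rank inequality `hrank`.
  omega

end Split

end Matrix

/-! ### The cost of the voting procedure -/

section Voting

variable {Γ : Type v} {F : Type u} [Field F] {act : Γ → F → F} {V : Type} {n : ℕ} {b b' c ω : ℝ}

/-- The square matrix with the given entries. -/
def entryMatrix (x : Fin n × Fin n → F) : Matrix (Fin n) (Fin n) F :=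
  Matrix.of fun i j => x (i, j)

/-- Computability of a square matrix, given by its entries. -/
def MatrixComputable (act : Γ → F → F) (b : ℝ) (f : (V → F) → Matrix (Fin n) (Fin n) F) : Prop :=
  TreeComputable act b fun x (p : Fin n × Fin n) => f x p.1 p.2

namespace MatrixComputable

lemma mul (h : LinAlgExponent F c ω) {f g : (V → F) → Matrix (Fin n) (Fin n) F}
    (hf : MatrixComputable act b f) (hg : MatrixComputable act b' g) :
    MatrixComputable act (b + b' + c * (n : ℝ) ^ ω) fun x => f x * g x := by
  obtain ⟨T, hT⟩ := h.1 n
  have hm : TreeComputable act (c * (n : ℝ) ^ ω)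
      (fun (y : Fin n × Fin n ⊕ Fin n × Fin n → F) (p : Fin n × Fin n) =>
        (entryMatrix (y ∘ Sum.inl) * entryMatrix (y ∘ Sum.inr)) p.1 p.2) := by
    refine ⟨T.liftUnary, fun y => ?_⟩
    rw [CompTree.eval_liftUnary, CompTree.cost_liftUnary]
    have := hT (entryMatrix (y ∘ Sum.inl)) (entryMatrix (y ∘ Sum.inr))
    have hy : Sum.elim (fun p : Fin n × Fin n => entryMatrix (y ∘ Sum.inl) p.1 p.2)
        (fun p : Fin n × Fin n => entryMatrix (y ∘ Sum.inr) p.1 p.2) = y := by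
      funext p; cases p <;> rfl
    simp only [hy] at this
    exact ⟨funext fun p => this.1 p.1 p.2, this.2⟩
  exact (TreeComputable.pair hf hg).comp hm

lemma of_entries {f : (Fin n × Fin n → F) → Matrix (Fin n) (Fin n) F}
    {g : (V → F) → Matrix (Fin n) (Fin n) F}
    (hg : MatrixComputable act b g) (hf : MatrixComputable act b' f) :
    MatrixComputable act (b + b') fun x => f fun p => g x p.1 p.2 :=
  TreeComputable.comp hg hf

end MatrixComputable

lemma exists_rowReduction (h : LinAlgExponent F c ω) (n : ℕ) :
    ∃ R : Matrix (Fin n) (Fin n) F → Matrix (Fin n) (Fin n) F,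
      (∀ A, (R A).IsReducedRowEchelon ∧ ∃ U, IsUnit U ∧ R A = U * A) ∧
      MatrixComputable act (c * (n : ℝ) ^ ω) fun x => R (entryMatrix x) := by
  obtain ⟨T, hT⟩ := h.2 n
  refine ⟨fun A => Matrix.of fun i j => T.eval noUnary (fun p => A p.1 p.2) (i, j),
    fun A => ⟨(hT A).1, (hT A).2.1⟩, T.liftUnary, fun x => ?_⟩
  rw [CompTree.eval_liftUnary, CompTree.cost_liftUnary]
  exact ⟨rfl, (hT (entryMatrix x)).2.2⟩

/-- One zero test per entry determines all pivots; the other `n ^ 2` operations load the zeros and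
ones. -/
lemma matrixComputable_leadMatrix :
    MatrixComputable act (2 * (n : ℝ) ^ 2) fun x : Fin n × Fin n → F =>
      (entryMatrix x).leadMatrix := by
  classical
  have h := TreeComputable.testAll (act := act) (F := F) (id : Fin n × Fin n → Fin n × Fin n)
    (g := fun s _ p => if (∀ j < p.2, (p.1, j) ∈ s) ∧ p ∉ s then (1 : F) else 0)
    (fun s => TreeComputable.indicator _)
  refine (h.congr fun x p => ?_).mono (le_of_eq ?_)
  · simp [Matrix.leadMatrix, Matrix.IsLeadingEntry, entryMatrix]
  · simp; ring

lemma exists_annihilator (h : LinAlgExponent F c ω) (n : ℕ) :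
    ∃ Z : Matrix (Fin n) (Fin n) F → Matrix (Fin n) (Fin n) F,
      (∀ B, (Z B).IsTriangularProjector B.rank ∧ B * Z B = 0) ∧
      MatrixComputable act (3 * (c * (n : ℝ) ^ ω) + 4 * (n : ℝ) ^ 2)
        fun x => Z (entryMatrix x) := by
  classical
  obtain ⟨R, hR, hRc⟩ := exists_rowReduction (act := act) h n
  refine ⟨fun B => 1 - (R B).leadMatrix.transpose * R B, fun B => ?_, ?_⟩
  · obtain ⟨hR1, U, hU, hRU⟩ := hR B
    refine ⟨?_, Matrix.mul_one_sub_leadMatrix_eq_zero hR1 hU hRU⟩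
    have := Matrix.isTriangularProjector_of_isReducedRowEchelon hR1
    rwa [show (R B).rank = B.rank by
      conv_lhs => rw [hRU]
      exact Matrix.rank_mul_eq_right_of_isUnit_det U B ((Matrix.isUnit_iff_isUnit_det U).1 hU)]
      at this
  · have hl : MatrixComputable act (c * (n : ℝ) ^ ω + 2 * (n : ℝ) ^ 2)
        fun x => (R (entryMatrix x)).leadMatrix :=
      hRc.of_entries matrixComputable_leadMatrix
    have hlt : MatrixComputable act (c * (n : ℝ) ^ ω + 2 * (n : ℝ) ^ 2)
        fun x => (R (entryMatrix x)).leadMatrix.transpose :=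
      TreeComputable.postcomp hl Prod.swap
    have hone := TreeComputable.indicator (act := act) (F := F) (V := Fin n × Fin n)
      (fun p : Fin n × Fin n => p.1 = p.2)
    refine ((hone.sub (hlt.mul h hRc)).congr fun x p => ?_).mono (le_of_eq ?_)
    · simp [Matrix.one_apply]
    · simp; ring

lemma exists_left_annihilator (h : LinAlgExponent F c ω) (n : ℕ) :
    ∃ Z : Matrix (Fin n) (Fin n) F → Matrix (Fin n) (Fin n) F,
      (∀ B, (Z B).IsTriangularProjector B.rank ∧ Z B * B = 0) ∧
      MatrixComputable act (3 * (c * (n : ℝ) ^ ω) + 4 * (n : ℝ) ^ 2)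
        fun x => Z (entryMatrix x) := by
  obtain ⟨Z, hZ, hZc⟩ := exists_annihilator (act := act) h n
  refine ⟨fun B => (Z B.antiTranspose).antiTranspose, fun B => ⟨?_, ?_⟩, ?_⟩
  · have := (hZ B.antiTranspose).1.antiTranspose
    rwa [Matrix.rank_antiTranspose] at this
  · have := congrArg Matrix.antiTranspose (hZ B.antiTranspose).2
    rw [Matrix.antiTranspose_mul, Matrix.antiTranspose_antiTranspose] at this
    rw [this]
    rfl
  · exact TreeComputable.postcomp
      (TreeComputable.precomp hZc fun p : Fin n × Fin n => (p.2.rev, p.1.rev))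
      fun p : Fin n × Fin n => (p.2.rev, p.1.rev)

/-- The votes on the diagonal of an `n × n` matrix can be computed in `b` operations. -/
def VotesComputable (act : Γ → F → F) (n : ℕ) (b : ℝ) : Prop :=
  ∃ f : (Fin n × Fin n → F) → Fin n ⊕ Fin n → F, TreeComputable act b f ∧
    ∀ N : Matrix (Fin n) (Fin n) F,
      N.IsVote (f (fun p => N p.1 p.2) ∘ Sum.inl) (f (fun p => N p.1 p.2) ∘ Sum.inr)

lemma votesComputable_one : VotesComputable act 1 1 := by
  have h := (TreeComputable.op (act := act) (F := F) (V := Fin 1 × Fin 1) (O := Fin 1) .one).pair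
    (TreeComputable.select fun p => (p, p))
  rw [add_zero] at h
  exact ⟨_, h, fun N => Matrix.isVote_one _⟩

/-- Votes on a triangular half, from those on the half multiplied by a projector. -/
lemma TreeComputable.halfVotes {f : (Fin n × Fin n → F) → Fin n ⊕ Fin n → F}
    (hf : TreeComputable act b f) {M Z : (V → F) → Matrix (Fin n) (Fin n) F} {b₁ b₂ : ℝ}
    (hM : MatrixComputable act b₁ M) (hZ : MatrixComputable act b₂ Z) :
    TreeComputable act (b + b₁ + b₂ + n) fun x => Sum.elim
      (fun p => f (fun q => M x q.1 q.2) (Sum.inl p) * Z x p p)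
      (fun p => f (fun q => M x q.1 q.2) (Sum.inr p)) := by
  have h1 := (TreeComputable.comp hM hf).pair (TreeComputable.postcomp hZ fun p : Fin n => (p, p))
  have h2 : TreeComputable act (0 + 0 + (Fintype.card (Fin n) : ℝ) + 0)
      (fun y : (Fin n ⊕ Fin n) ⊕ Fin n → F => Sum.elim
        (fun p : Fin n => y (Sum.inl (Sum.inl p)) * y (Sum.inr p))
        (fun p : Fin n => y (Sum.inl (Sum.inr p)))) :=
    ((TreeComputable.select _).mul (TreeComputable.select _)).pair (TreeComputable.select _)
  refine ((h1.comp h2).congr fun x p => ?_).mono (le_of_eq ?_)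
  · cases p <;> rfl
  · simp; ring

lemma VotesComputable.double (h : LinAlgExponent F c ω) (hv : VotesComputable act (F := F) n b) :
    VotesComputable act (F := F) (n + n)
      (2 * b + 14 * (c * (n : ℝ) ^ ω) + 16 * (n : ℝ) ^ 2 + 2 * n) := by
  obtain ⟨f, hf, hfv⟩ := hv
  obtain ⟨Z, hZ, hZc⟩ := exists_annihilator (act := act) h n
  obtain ⟨Z', hZ', hZc'⟩ := exists_left_annihilator (act := act) h n
  let blk (s t : Fin n → Fin (n + n)) (x : Fin (n + n) × Fin (n + n) → F) :
      Matrix (Fin n) (Fin n) F := (entryMatrix x).submatrix s t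
  have hblk (s t) : MatrixComputable act 0 (blk s t) :=
    TreeComputable.select fun p : Fin n × Fin n => (s p.1, t p.2)
  have hcZ := (hblk (Fin.natAdd n) (Fin.castAdd n)).of_entries hZc
  have hcZ' := (hblk (Fin.natAdd n) (Fin.castAdd n)).of_entries hZc'
  have h1 := hf.halfVotes ((hblk (Fin.castAdd n) (Fin.castAdd n)).mul h hcZ) hcZ
  -- Each annihilator is computed twice, once for the product and once for its diagonal. With the
  -- product this gives `2 * 3 + 1 = 7` calls of linear algebra per half.
  have h2 := hf.halfVotes (hcZ'.mul h (hblk (Fin.natAdd n) (Fin.natAdd n))) hcZ'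
  have h3 := (h1.pair h2).postcomp (Sum.elim
    (Fin.append (fun p : Fin n => Sum.inl (Sum.inl p)) fun p => Sum.inr (Sum.inl p))
    (Fin.append (fun p : Fin n => Sum.inl (Sum.inr p)) fun p => Sum.inr (Sum.inr p)))
  refine ⟨_, h3.mono (le_of_eq (by ring)), fun N => ?_⟩
  have := Matrix.isVote_append N (hZ _).1 (hZ' _).1 (hZ _).2 (hZ' _).2
    (hfv _) (hfv _)
  convert this using 1
  · funext p
    refine Fin.addCases (fun p => ?_) (fun p => ?_) p
    · simp only [Function.comp, Sum.elim_inl, Fin.append_left]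
      rfl
    · simp only [Function.comp, Sum.elim_inl, Fin.append_right]
      rfl
  · funext p
    refine Fin.addCases (fun p => ?_) (fun p => ?_) p
    · simp only [Function.comp, Sum.elim_inr, Fin.append_left]
      rfl
    · simp only [Function.comp, Sum.elim_inr, Fin.append_right]
      rfl

lemma votesComputable_two_pow (h : LinAlgExponent F c ω) (hω : 2 ≤ ω) (l : ℕ) :
    VotesComputable act (F := F) (2 ^ l) ((14 * |c| + 18) * ((2 ^ l : ℕ) : ℝ) ^ ω) := by
  induction l with
  | zero =>
    obtain ⟨f, hf, hv⟩ := votesComputable_one (F := F) (act := act)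
    refine ⟨f, hf.mono ?_, hv⟩
    simp
    linarith [abs_nonneg c]
  | succ l ih =>
    have hd := ih.double h
    rw [pow_succ, mul_two]
    obtain ⟨f, hf, hv⟩ := hd
    refine ⟨f, hf.mono ?_, hv⟩
    have h1 : (1 : ℝ) ≤ ((2 ^ l : ℕ) : ℝ) := by exact_mod_cast Nat.one_le_two_pow
    set N : ℝ := ((2 ^ l : ℕ) : ℝ)
    have hN2 : N ^ 2 ≤ N ^ ω := by
      rw [← Real.rpow_natCast]
      exact Real.rpow_le_rpow_of_exponent_le h1 (by exact_mod_cast hω)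
    have hN1 : N ≤ N ^ 2 := by nlinarith
    -- Doubling the size multiplies the bound by at least `4`, while the recursion only doubles the
    -- cost; the slack absorbs the linear algebra, so no logarithm appears even for `ω = 2`.
    have h4 : (4 : ℝ) ≤ 2 ^ ω := by
      calc (4 : ℝ) = 2 ^ (2 : ℝ) := by norm_num
        _ ≤ 2 ^ ω := Real.rpow_le_rpow_of_exponent_le (by norm_num) hω
    have h5 : (((2 ^ l + 2 ^ l : ℕ) : ℝ)) ^ ω = 2 ^ ω * N ^ ω := by
      rw [← Real.mul_rpow (by norm_num) (by linarith)]
      congr 1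
      push_cast [N]
      ring
    rw [h5]
    have hX : 0 ≤ N ^ ω := by positivity
    have hc : c * N ^ ω ≤ |c| * N ^ ω := mul_le_mul_of_nonneg_right (le_abs_self c) hX
    have hcc : 0 ≤ (14 * |c| + 18) * N ^ ω := mul_nonneg (by positivity) hX
    have := mul_le_mul_of_nonneg_left h4 hcc
    linarith

end Voting

/-! ### Recovering a diagonal entry by majority vote -/

section Majority

/-- Two subsets of `S`, each of more than half its size, intersect. -/
lemma eq_of_majority {ι α : Type*} [DecidableEq α] [DecidableEq ι] (S : Finset ι)
    (g : ι → α) {e a : α}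
    (he : S.card < 2 * (S.filter fun q => g q = e).card)
    (ha : S.card < 2 * (S.filter fun q => a = g q).card) : a = e := by
  by_contra hne
  have hd : Disjoint (S.filter fun q => g q = e) (S.filter fun q => a = g q) := by
    rw [Finset.disjoint_filter]
    intro q _ h1 h2
    exact hne (h2.trans h1)
  have := Finset.card_le_card (Finset.union_subset (Finset.filter_subset (fun q => g q = e) S)
    (Finset.filter_subset (fun q => a = g q) S))
  rw [Finset.card_union_of_disjoint hd] at this
  omega

variable {Γ : Type v} {F : Type u} [Field F] {act : Γ → F → F} {V : Type} {c ω : ℝ}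

open Classical in
/-- `p` has a valid vote that agrees with more than half of the valid votes; `s` is the set of
zeros among the marks and the differences of votes. -/
def IsMajority {M : ℕ} (s : Set (Fin M ⊕ Fin M × Fin M)) (p : Fin M) : Prop :=
  (Finset.univ.filter fun q => Sum.inl q ∉ s).card <
    2 * ((Finset.univ.filter fun q => Sum.inl q ∉ s).filter fun q => Sum.inr (p, q) ∈ s).card

lemma treeComputable_majority (M : ℕ) [NeZero M] :
    ∃ f : (Fin M ⊕ Fin M → F) → Unit → F,
      TreeComputable act (2 * (M : ℝ) ^ 2 + M) f ∧
      ∀ (y : Fin M ⊕ Fin M → F) (e : F),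
        {p | y (Sum.inl p) = 0}.ncard +
          2 * {p | y (Sum.inl p) ≠ 0 ∧ y (Sum.inr p) ≠ e}.ncard < M → f y () = e := by
  classical
  have h1 : TreeComputable act (0 + (0 + 0 + (Fintype.card (Fin M × Fin M) : ℝ)))
      (fun y : Fin M ⊕ Fin M → F => Sum.elim (fun o => y (id o))
        (fun p : Fin M × Fin M => y (Sum.inr p.1) - y (Sum.inr p.2))) :=
    (TreeComputable.select id).pair ((TreeComputable.select _).sub (TreeComputable.select _))
  -- The winner depends only on the outcomes of the tests, so choosing it is part of the shape of
  -- the tree and costs nothing.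
  let win : Set (Fin M ⊕ Fin M × Fin M) → Fin M := fun s =>
    if h : ∃ p, IsMajority s p then h.choose else 0
  have h2 := TreeComputable.testAll (act := act) (F := F) (O := Unit) (b := 0)
    (V := (Fin M ⊕ Fin M) ⊕ Fin M × Fin M)
    (Sum.elim (fun p => Sum.inl (Sum.inl p)) Sum.inr : Fin M ⊕ Fin M × Fin M → _)
    (g := fun s y _ => y (Sum.inl (Sum.inr (win s)))) (fun s => TreeComputable.select _)
  refine ⟨_, (h1.comp h2).mono (le_of_eq ?_), fun y e hy => ?_⟩
  · simp; ring
  set s : Set (Fin M ⊕ Fin M × Fin M) := {q | (Sum.elim (fun o => y (id o))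
    (fun p : Fin M × Fin M => y (Sum.inr p.1) - y (Sum.inr p.2)) : _ → F)
      (Sum.elim (fun p => Sum.inl (Sum.inl p)) Sum.inr q) = 0} with hs
  change y (Sum.inr (win s)) = e
  let S : Finset (Fin M) := Finset.univ.filter fun q => y (Sum.inl q) ≠ 0
  have hl : ∀ q, Sum.inl q ∈ s ↔ y (Sum.inl q) = 0 := fun q => Iff.rfl
  have hr : ∀ p q, Sum.inr (p, q) ∈ s ↔ y (Sum.inr p) = y (Sum.inr q) := fun p q => sub_eq_zero
  have hmaj : ∀ p, IsMajority s p ↔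
      S.card < 2 * (S.filter fun q => y (Sum.inr p) = y (Sum.inr q)).card := by
    intro p
    simp only [IsMajority, hl, hr, S]
  have hS : S.card < 2 * (S.filter fun q => y (Sum.inr q) = e).card := by
    have e1 : {p | y (Sum.inl p) = 0}.ncard = Sᶜ.card := by
      rw [← Set.ncard_coe_finset]; congr 1; ext p; simp [S]
    have e2 : {p | y (Sum.inl p) ≠ 0 ∧ y (Sum.inr p) ≠ e}.ncard =
        (S.filter fun q => ¬ y (Sum.inr q) = e).card := by
      rw [← Set.ncard_coe_finset]; congr 1; ext p; simp [S]
    have e3 := Finset.card_filter_add_card_filter_not (s := S) (fun q => y (Sum.inr q) = e)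
    have e4 := Finset.card_add_card_compl S
    rw [Fintype.card_fin] at e4
    omega
  have hex : ∃ p, IsMajority s p := by
    have hpos : 0 < (S.filter fun q => y (Sum.inr q) = e).card := by omega
    obtain ⟨p, hp⟩ := Finset.card_pos.1 hpos
    refine ⟨p, (hmaj p).2 ?_⟩
    rw [(Finset.mem_filter.1 hp).2]
    simpa only [eq_comm] using hS
  have hwin : IsMajority s (win s) := by
    simp only [win, dif_pos hex]
    exact hex.choose_spec
  exact eq_of_majority S (fun q => y (Sum.inr q)) hS ((hmaj _).1 hwin)

lemma rank_zeroPad_le {m n : ℕ} [NeZero m] (A : Matrix (Fin m) (Fin m) F) :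
    (Matrix.of fun i j : Fin n => if (i : ℕ) < m ∧ (j : ℕ) < m then
      A (Fin.ofNat m i) (Fin.ofNat m j) else 0).rank ≤ A.rank := by
  let D : Matrix (Fin n) (Fin n) F := Matrix.diagonal fun i => if (i : ℕ) < m then 1 else 0
  have h : (Matrix.of fun i j : Fin n => if (i : ℕ) < m ∧ (j : ℕ) < m then
      A (Fin.ofNat m i) (Fin.ofNat m j) else 0) =
      D * (A.submatrix (fun i : Fin n => Fin.ofNat m i) (fun i : Fin n => Fin.ofNat m i)) * D := by
    ext i j
    simp only [D, Matrix.mul_diagonal, Matrix.diagonal_mul, Matrix.of_apply, Matrix.submatrix_apply]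
    by_cases hi : (i : ℕ) < m <;> by_cases hj : (j : ℕ) < m <;> simp [hi, hj]
  rw [h]
  exact (Matrix.rank_mul_le_left _ _).trans ((Matrix.rank_mul_le_right _ _).trans
    (Matrix.rank_submatrix_le _ _ _))

/-- A constant for the cost of recovering one coefficient. -/
noncomputable def recoveryConst (c ω : ℝ) : ℝ := (14 * |c| + 25) * 4 ^ ω

/-- If a matrix of rank at most `t` and size `2 * t + 1` is known strictly below the diagonal and its
diagonal entries are conjugates of a single element `e`, then `e` can be computed by majority
vote. -/
lemma exists_recovery (h : LinAlgExponent F c ω) (hω : 2 ≤ ω) {t M : ℕ}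
    (hM : M = 2 * t + 1)
    (entry : ∀ p q : Fin M, q < p → V) (γ γ' : Fin M → Γ)
    (hγ : ∀ p x, act (γ' p) (act (γ p) x) = x) :
    ∃ f : (V → F) → Unit → F,
      TreeComputable act (recoveryConst c ω * ((t : ℝ) + 1) ^ ω) f ∧
      ∀ (x : V → F) (e : F) (A : Matrix (Fin M) (Fin M) F), A.rank ≤ t →
        (∀ p q (hpq : q < p), A p q = act (γ q) (x (entry p q hpq))) →
        (∀ p, A p p = act (γ p) e) → f x () = e := by
  classical
  have : NeZero M := ⟨by omega⟩
  -- The matrix is padded by zeros to a power of `2` of size at most `2 * M ≤ 4 * (t + 1)`, whence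
  -- the factor `4 ^ ω` in `recoveryConst`.
  set l := Nat.log 2 M + 1 with hl
  have hMn : M ≤ 2 ^ l := (Nat.lt_pow_succ_log_self (by norm_num) M).le
  have hnM : 2 ^ l ≤ 2 * M := by
    rw [hl, pow_succ, mul_comm]
    exact Nat.mul_le_mul_left 2 (Nat.pow_log_le_self 2 (by omega))
  obtain ⟨v, hv, hvote⟩ := votesComputable_two_pow (act := act) h hω l
  obtain ⟨maj, hmaj, hmaj'⟩ := treeComputable_majority (act := act) (F := F) M
  generalize 2 ^ l = n at *
  let N : (V → F) → Matrix (Fin n) (Fin n) F := fun x => Matrix.of fun i j =>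
    if hij : ((i : ℕ) < M ∧ (j : ℕ) < M) ∧ j < i then
      act (γ ⟨j, hij.1.2⟩) (x (entry ⟨i, hij.1.1⟩ ⟨j, hij.1.2⟩ hij.2)) else 0
  have hN : TreeComputable act (Fintype.card (Fin n × Fin n) * 1)
      (fun x (p : Fin n × Fin n) => N x p.1 p.2) := by
    refine TreeComputable.family fun p => ?_
    by_cases hp : ((p.1 : ℕ) < M ∧ (p.2 : ℕ) < M) ∧ p.2 < p.1
    · simp only [N, Matrix.of_apply, dif_pos hp]
      exact TreeComputable.op (.app _ _)
    · simp only [N, Matrix.of_apply, dif_neg hp]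
      exact TreeComputable.op .zero
  let g : (Fin n ⊕ Fin n → F) → Fin M ⊕ Fin M → F := fun y => Sum.elim
    (fun p => y (Sum.inl (Fin.castLE hMn p)))
    -- The diagonal of `N` is filled with zeros, so a vote is `0 - ν p`. Applying the inverse
    -- automorphism turns votes on the conjugates of `e` into votes on `e` itself.
    (fun p => act (γ' p) ((if False then 1 else 0) - y (Sum.inr (Fin.castLE hMn p))))
  have hg : TreeComputable act _ g :=
    (TreeComputable.select _).pair
      (((TreeComputable.indicator fun _ => False).sub (TreeComputable.select _)).app γ')
  refine ⟨_, (((hN.comp hv).comp hg).comp hmaj).mono ?_, fun x e A hA hlow hdiag => ?_⟩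
  · have hn1 : (n : ℝ) ≤ 4 * (t + 1) := by
      have : (n : ℝ) ≤ ((2 * M : ℕ) : ℝ) := by exact_mod_cast hnM
      push_cast [hM] at this
      linarith
    have hM1 : (1 : ℝ) ≤ M := by exact_mod_cast (by omega : 1 ≤ M)
    have hMn1 : (M : ℝ) ≤ n := by exact_mod_cast hMn
    have hn2 : (n : ℝ) ^ 2 ≤ (n : ℝ) ^ ω := by
      rw [← Real.rpow_natCast]
      exact Real.rpow_le_rpow_of_exponent_le (hM1.trans hMn1) (by exact_mod_cast hω)
    have hn3 : (n : ℝ) ^ ω ≤ 4 ^ ω * ((t : ℝ) + 1) ^ ω := by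
      rw [← Real.mul_rpow (by norm_num) (by positivity)]
      exact Real.rpow_le_rpow (by positivity) hn1 (by linarith)
    have hM2 : (M : ℝ) ^ 2 ≤ (n : ℝ) ^ 2 := by gcongr
    have hM3 : (M : ℝ) ≤ (M : ℝ) ^ 2 := by nlinarith
    have hfin : (14 * |c| + 25) * (n : ℝ) ^ ω ≤ (14 * |c| + 25) * (4 ^ ω * ((t : ℝ) + 1) ^ ω) :=
      mul_le_mul_of_nonneg_left hn3 (by positivity)
    simp only [Fintype.card_prod, Fintype.card_fin, Nat.cast_mul]
    -- `25 = 18 + 1 + 3 + 3`: the votes, loading `N`, undoing the conjugations, and the majority.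
    rw [recoveryConst]
    nlinarith
  · let A' : Matrix (Fin n) (Fin n) F := Matrix.of fun i j =>
      if (i : ℕ) < M ∧ (j : ℕ) < M then A (Fin.ofNat M i) (Fin.ofNat M j) else 0
    have hof : ∀ (i : Fin n) (hi : (i : ℕ) < M), Fin.ofNat M i = ⟨i, hi⟩ := fun i hi =>
      Fin.ext (Nat.mod_eq_of_lt hi)
    have hA' : A'.rank ≤ t := (rank_zeroPad_le A).trans hA
    have hvt := hvote (N x) A' fun i j hij => by
      simp only [A', N, Matrix.of_apply]
      by_cases hi : (i : ℕ) < M ∧ (j : ℕ) < M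
      · rw [if_pos hi, dif_pos ⟨hi, hij⟩, hof i hi.1, hof j hi.2, hlow _ _ hij]
      · rw [if_neg hi, dif_neg fun h => hi h.1]
    -- Discarding the voters from the padding can only lower the counts, and `2 * t < M`.
    apply hmaj'
    set y := v fun p => N x p.1 p.2
    have k1 : {p | g y (Sum.inl p) = 0}.ncard ≤ {p | (y ∘ Sum.inl) p = 0}.ncard := by
      rw [← Set.ncard_image_of_injective {p | g y (Sum.inl p) = 0} (Fin.castLE_injective hMn)]
      refine Set.ncard_le_ncard ?_ (Set.toFinite _)
      rintro _ ⟨p, hp, rfl⟩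
      exact hp
    have k2 : {p | g y (Sum.inl p) ≠ 0 ∧ g y (Sum.inr p) ≠ e}.ncard ≤
        {p | (y ∘ Sum.inl) p ≠ 0 ∧ A' p p ≠ N x p p - (y ∘ Sum.inr) p}.ncard := by
      rw [← Set.ncard_image_of_injective {p | g y (Sum.inl p) ≠ 0 ∧ g y (Sum.inr p) ≠ e}
        (Fin.castLE_injective hMn)]
      refine Set.ncard_le_ncard ?_ (Set.toFinite _)
      rintro _ ⟨p, ⟨hp, hp'⟩, rfl⟩
      refine ⟨hp, fun heq => hp' ?_⟩
      have hpM : ((Fin.castLE hMn p : Fin n) : ℕ) < M := p.2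
      simp only [A', N, Matrix.of_apply, lt_irrefl, and_false, dite_false] at heq
      rw [if_pos ⟨hpM, hpM⟩, hof _ hpM] at heq
      simp only [g, Sum.elim_inr, if_false]
      rw [← hγ p e, ← hdiag p]
      exact congrArg _ heq.symm
    omega

end Majority

/-! ### Exponents -/

section Exponents

variable {K : Type u} {L : Type v} [Field K] [Field L] [Algebra K L]
  {m : ℕ} {n : Fin m → ℕ} {θ : Fin m → Gal(L/K)}

/-- The monomial `θ₁^{a₁} ⋯ θ_m^{a_m}` with integral exponents. -/
def thetaZPow (θ : Fin m → Gal(L/K)) (a : Fin m → ℤ) : Gal(L/K) :=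
  (List.ofFn fun j => θ j ^ a j).prod

lemma thetaPow_eq_thetaZPow (θ : Fin m → Gal(L/K)) (i : ExpSet n) :
    thetaPow θ i = thetaZPow θ fun j => ((i j : ℕ) : ℤ) := by
  simp [thetaPow, thetaZPow]

namespace IsCyclicDecomposition

lemma thetaZPow_congr (h : IsCyclicDecomposition n θ) {a b : Fin m → ℤ}
    (hab : ∀ j, (n j : ℤ) ∣ a j - b j) : thetaZPow θ a = thetaZPow θ b := by
  simp only [thetaZPow]
  congr 2
  funext j
  rw [← sub_add_cancel (a j) (b j), zpow_add]
  have : θ j ^ (a j - b j) = 1 := by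
    rw [← orderOf_dvd_iff_zpow_eq_one, h.orderOf_eq]
    exact hab j
  rw [this, one_mul]

lemma pos [FiniteDimensional K L] (h : IsCyclicDecomposition n θ) (j : Fin m) : 0 < n j := by
  rw [← h.orderOf_eq j]
  exact orderOf_pos _

variable [FiniteDimensional K L]

/-- The reduction of an integral exponent vector. -/
def reduce (h : IsCyclicDecomposition n θ) (a : Fin m → ℤ) : ExpSet n := fun j =>
  ⟨(a j % n j).toNat, by
    have := h.pos j
    have h1 := Int.emod_nonneg (a j) (by omega : (n j : ℤ) ≠ 0)
    have h2 := Int.emod_lt_of_pos (a j) (by omega : (0 : ℤ) < n j)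
    omega⟩

lemma coe_reduce (h : IsCyclicDecomposition n θ) (a : Fin m → ℤ) (j : Fin m) :
    (((h.reduce a j : Fin (n j)) : ℕ) : ℤ) = a j % n j := by
  have := h.pos j
  exact Int.toNat_of_nonneg (Int.emod_nonneg (a j) (by omega : (n j : ℤ) ≠ 0))

lemma thetaPow_reduce (h : IsCyclicDecomposition n θ) (a : Fin m → ℤ) :
    thetaPow θ (h.reduce a) = thetaZPow θ a := by
  rw [thetaPow_eq_thetaZPow]
  refine h.thetaZPow_congr fun j => ?_
  rw [h.coe_reduce]
  exact (Int.mod_modEq (a j) (n j)).symm.dvd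

lemma thetaZPow_eq_iff (h : IsCyclicDecomposition n θ) {a b : Fin m → ℤ} :
    thetaZPow θ a = thetaZPow θ b ↔ ∀ j, (n j : ℤ) ∣ a j - b j := by
  refine ⟨fun hab j => ?_, h.thetaZPow_congr⟩
  rw [← h.thetaPow_reduce, ← h.thetaPow_reduce] at hab
  have := congrFun (h.bijective.1 hab) j
  have h2 := h.coe_reduce a j
  rw [this, h.coe_reduce b j] at h2
  exact (show b j ≡ a j [ZMOD n j] from h2).dvd

end IsCyclicDecomposition

section Commutative

variable [IsMulCommutative Gal(L/K)]

lemma thetaZPow_add (θ : Fin m → Gal(L/K)) (a b : Fin m → ℤ) :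
    thetaZPow θ (a + b) = thetaZPow θ a * thetaZPow θ b := by
  let _ : CommGroup Gal(L/K) := { (inferInstance : Group Gal(L/K)) with mul_comm := mul_comm' }
  simp only [thetaZPow, Pi.add_apply, zpow_add, List.prod_ofFn]
  exact Finset.prod_mul_distrib

lemma thetaZPow_zero (θ : Fin m → Gal(L/K)) : thetaZPow θ 0 = 1 := by
  have h := thetaZPow_add θ 0 0
  rw [add_zero] at h
  exact left_eq_mul.1 h

lemma thetaZPow_neg (θ : Fin m → Gal(L/K)) (a : Fin m → ℤ) :
    thetaZPow θ (-a) = (thetaZPow θ a)⁻¹ := by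
  rw [eq_inv_iff_mul_eq_one, ← thetaZPow_add, neg_add_cancel, thetaZPow_zero]

lemma thetaZPow_single (θ : Fin m → Gal(L/K)) (j : Fin m) (a : ℤ) :
    thetaZPow θ (Pi.single j a) = θ j ^ a := by
  let _ : CommGroup Gal(L/K) := { (inferInstance : Group Gal(L/K)) with mul_comm := mul_comm' }
  rw [thetaZPow, List.prod_ofFn]
  refine (Finset.prod_eq_single j (fun k _ hk => ?_) fun h => absurd (Finset.mem_univ j) h).trans ?_
  · rw [Pi.single_eq_of_ne hk, zpow_zero]
  · rw [Pi.single_eq_same]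

namespace IsCyclicDecomposition

lemma dvd_of_mul_eq [FiniteDimensional K L] (h : IsCyclicDecomposition n θ) {i j k : ExpSet n}
    (hij : thetaPow θ j * thetaPow θ i = thetaPow θ k) (u : Fin m) :
    (n u : ℤ) ∣ ((j u : ℕ) : ℤ) + ((i u : ℕ) : ℤ) - ((k u : ℕ) : ℤ) := by
  rw [thetaPow_eq_thetaZPow, thetaPow_eq_thetaZPow, thetaPow_eq_thetaZPow, ← thetaZPow_add,
    h.thetaZPow_eq_iff] at hij
  exact hij u

end IsCyclicDecomposition

end Commutative

/-- The exponents `s` for which `w + s` does not wrap around. -/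
def expBox (w : ExpSet n) : Finset (ExpSet n) :=
  Finset.univ.filter fun s => ∀ u, (w u : ℕ) + (s u : ℕ) < n u

lemma mem_expBox {w s : ExpSet n} : s ∈ expBox w ↔ ∀ u, (w u : ℕ) + (s u : ℕ) < n u := by
  simp [expBox]

/-- The sum of two exponents that does not wrap around. -/
def expAdd (w s : ExpSet n) (h : s ∈ expBox w) : ExpSet n := fun u =>
  ⟨(w u : ℕ) + (s u : ℕ), mem_expBox.1 h u⟩

lemma expAdd_injective {w s s' : ExpSet n} (h : s ∈ expBox w) (h' : s' ∈ expBox w)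
    (e : expAdd w s h = expAdd w s' h') : s = s' := by
  funext u
  have := congrArg Fin.val (congrFun e u)
  simp only [expAdd] at this
  exact Fin.ext (by omega)

variable [IsMulCommutative Gal(L/K)]

lemma thetaPow_expAdd {w s : ExpSet n} (h : s ∈ expBox w) :
    thetaPow θ (expAdd w s h) = thetaPow θ s * thetaPow θ w := by
  rw [thetaPow_eq_thetaZPow, thetaPow_eq_thetaZPow, thetaPow_eq_thetaZPow, ← thetaZPow_add]
  congr 1
  funext u
  simp [expAdd, add_comm]

/-- At the highest coordinate `u` where `j` and `s` differ, `i u` is congruent to `w u + s u - j u`,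
which lies strictly between `w u` and `n u` because `s` is in the box. Above `u`, `i` and `w` agree.
-/
lemma IsCyclicDecomposition.lt_of_mul_eq_expAdd [FiniteDimensional K L]
    (h : IsCyclicDecomposition n θ) {w s j i : ExpSet n} (hs : s ∈ expBox w)
    (hjs : toColex j < toColex s)
    (hij : thetaPow θ j * thetaPow θ i = thetaPow θ (expAdd w s hs)) :
    toColex w < toColex i := by
  obtain ⟨u, hu, hlt⟩ := hjs
  have hd := h.dvd_of_mul_eq hij
  refine ⟨u, fun v hv => ?_, ?_⟩
  · have h1 := hd v
    have h2 : j v = s v := hu v hv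
    simp only [expAdd, h2] at h1
    have h3 : (n v : ℤ) ∣ ((i v : ℕ) : ℤ) - ((w v : ℕ) : ℤ) := by
      convert h1 using 1
      push_cast
      ring
    have h4 := Int.eq_zero_of_abs_lt_dvd h3 (by
      have := (i v).2; have := (w v).2
      rw [abs_lt]; constructor <;> omega)
    exact Fin.ext (by change (w v : ℕ) = (i v : ℕ); omega)
  · have h1 := hd u
    have h2 : (j u : ℕ) < (s u : ℕ) := hlt
    have hsu := mem_expBox.1 hs u
    simp only [expAdd] at h1
    have h4 := Int.eq_zero_of_abs_lt_dvd h1 (by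
      have := (i u).2; have := (w u).2
      rw [abs_lt]; constructor <;> push_cast <;> omega)
    change (w u : ℕ) < (i u : ℕ)
    push_cast at h4
    omega

end Exponents

/-! ### The rank metric -/

namespace SkewGalAlgebra

variable {K : Type u} {L : Type v} [Field K] [Field L] [Algebra K L]

lemma linearIndependent_gal :
    LinearIndependent L fun g : Gal(L/K) => g.toLinearMap :=
  (linearIndependent_toLinearMap K L L).comp (fun g : Gal(L/K) => (g : L →ₐ[K] L))
    fun _ _ h => AlgEquiv.ext fun x => DFunLike.congr_fun h x

variable [FiniteDimensional K L]

lemma toEnd_eq_sum (A : SkewGalAlgebra K L) :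
    toEnd A = ∑ g : Gal(L/K), A.coeff g • g.toLinearMap := by
  rw [toEnd, SkewMonoidAlgebra.sum_def, Finsupp.sum_fintype]
  intro g
  rw [zero_smul]

lemma toEnd_apply (A : SkewGalAlgebra K L) (x : L) :
    toEnd A x = ∑ g : Gal(L/K), A.coeff g * g x := by
  simp [toEnd_eq_sum, LinearMap.sum_apply]

lemma toEnd_sub (A B : SkewGalAlgebra K L) : toEnd (A - B) = toEnd A - toEnd B := by
  ext x
  simp only [LinearMap.sub_apply, toEnd_apply, SkewMonoidAlgebra.coeff_sub, Finsupp.coe_sub,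
    Pi.sub_apply, sub_mul, Finset.sum_sub_distrib]

lemma toEnd_eq_zero_iff {A : SkewGalAlgebra K L} : toEnd A = 0 ↔ A = 0 := by
  refine ⟨fun h => ?_, fun h => by simp [h, toEnd_eq_sum]⟩
  rw [toEnd_eq_sum] at h
  have h0 := Fintype.linearIndependent_iff.1 (linearIndependent_gal (K := K) (L := L))
    (fun g => A.coeff g) h
  refine SkewMonoidAlgebra.ext fun g => ?_
  rw [h0 g, SkewMonoidAlgebra.coeff_zero, Finsupp.zero_apply]

lemma rk_eq_zero_iff {A : SkewGalAlgebra K L} : rk A = 0 ↔ A = 0 := by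
  rw [rk, Submodule.finrank_eq_zero, LinearMap.range_eq_bot, toEnd_eq_zero_iff]

lemma rk_sub_le (A B : SkewGalAlgebra K L) : rk (A - B) ≤ rk A + rk B := by
  have h : LinearMap.range (toEnd (A - B)) ≤
      LinearMap.range (toEnd A) ⊔ LinearMap.range (toEnd B) := by
    rintro _ ⟨x, rfl⟩
    rw [toEnd_sub, LinearMap.sub_apply]
    exact Submodule.sub_mem _ (Submodule.mem_sup_left ⟨x, rfl⟩) (Submodule.mem_sup_right ⟨x, rfl⟩)
  exact (Submodule.finrank_mono h).trans (Submodule.finrank_add_le_finrank_add_finrank _ _)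

end SkewGalAlgebra

/-! ### Rank of the Dickson matrix and dimension of the code. -/

section Code

open SkewGalAlgebra

variable {K : Type u} {L : Type v} [Field K] [Field L] [Algebra K L] [FiniteDimensional K L]
  {m : ℕ} {n : Fin m → ℕ} {θ : Fin m → Gal(L/K)}

/-- The Dickson matrix has rank at most the rank of the endomorphism. -/
lemma IsCyclicDecomposition.rank_dicksonMatrix_le (h : IsCyclicDecomposition n θ)
    (E : SkewGalAlgebra K L) : (dicksonMatrix (n := n) θ E).rank ≤ rk E := by
  classical
  let e : ExpSet n ≃ Gal(L/K) := Equiv.ofBijective _ h.bijective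
  let Θ : L →ₗ[K] (ExpSet n → L) := LinearMap.pi fun i => (e i).toLinearMap
  -- The transposed Dickson matrix is `E` acting on vectors of conjugates. By independence of
  -- automorphisms these span the whole space over `L`, so its range is spanned by the conjugate
  -- vectors of a `K`-basis of the range of `E`.
  have hΘ : ∀ x, (dicksonMatrix (n := n) θ E).transpose.mulVec (Θ x) = Θ (toEnd E x) := by
    intro x
    funext j
    rw [Matrix.mulVec, dotProduct]
    change ∑ i, (e j) (E.coeff ((e j)⁻¹ * e i)) * (e i) x = (e j) (toEnd E x)
    rw [toEnd_apply, map_sum, ← Equiv.sum_comp (Equiv.mulLeft (e j)⁻¹), ← Equiv.sum_comp e]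
    refine Finset.sum_congr rfl fun i _ => ?_
    rw [map_mul (e j), Equiv.coe_mulLeft]
    congr 1
    exact ((e j).apply_symm_apply _).symm
  have hspan : Submodule.span L (Set.range Θ) = ⊤ := by
    by_contra hne
    obtain ⟨φ, hφ, hle⟩ := Submodule.exists_le_ker_of_lt_top _ (lt_top_iff_ne_top.2 hne)
    apply hφ
    have hc : ∀ i, φ (Pi.single i 1) = 0 := by
      have hli := (linearIndependent_gal (K := K) (L := L)).comp e e.injective
      refine Fintype.linearIndependent_iff.1 hli _ (LinearMap.ext fun x => ?_)
      have h0 : φ (Θ x) = 0 := hle (Submodule.subset_span ⟨x, rfl⟩)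
      rw [LinearMap.pi_apply_eq_sum_univ φ (Θ x)] at h0
      simp only [LinearMap.sum_apply, LinearMap.smul_apply, LinearMap.zero_apply]
      rw [← h0]
      refine Finset.sum_congr rfl fun i _ => ?_
      rw [smul_eq_mul, smul_eq_mul, mul_comm]
      congr 2
      funext k
      simp [Pi.single_apply, eq_comm]
    refine LinearMap.pi_ext' fun i => LinearMap.ext_ring ?_
    simpa using hc i
  rw [← Matrix.rank_transpose, Matrix.rank]
  have hle : LinearMap.range (dicksonMatrix (n := n) θ E).transpose.mulVecLin ≤
      Submodule.span L ((LinearMap.range (toEnd E)).map Θ : Set (ExpSet n → L)) := by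
    rw [LinearMap.range_eq_map, ← hspan, Submodule.map_span, Submodule.span_le]
    rintro _ ⟨_, ⟨x, rfl⟩, rfl⟩
    refine Submodule.subset_span ⟨toEnd E x, ⟨x, rfl⟩, ?_⟩
    rw [Matrix.mulVecLin_apply, hΘ]
  refine (Submodule.finrank_mono hle).trans ?_
  let b := Module.finBasis K (LinearMap.range (toEnd E))
  have hb : Submodule.span L ((LinearMap.range (toEnd E)).map Θ : Set (ExpSet n → L)) ≤
      Submodule.span L (Set.range fun i => Θ (b i : L)) := by
    rw [Submodule.span_le]
    rintro _ ⟨y, hy, rfl⟩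
    have hsum := b.sum_repr ⟨y, hy⟩
    have hy' : y = ∑ i, b.repr ⟨y, hy⟩ i • (b i : L) := by
      have := congrArg (LinearMap.range (toEnd E)).subtype hsum
      rw [map_sum] at this
      exact this.symm
    rw [hy', map_sum]
    refine Submodule.sum_mem _ fun i _ => ?_
    rw [map_smul, ← algebraMap_smul L]
    exact Submodule.smul_mem _ _ (Submodule.subset_span ⟨i, rfl⟩)
  refine (Submodule.finrank_mono hb).trans ((finrank_range_le_card _).trans ?_)
  rw [Fintype.card_fin, rk]

/-- The dimension of the code is at least the number of exponents of degree at most `r`. -/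
lemma IsCyclicDecomposition.card_le_finrank_rankRM (h : IsCyclicDecomposition n θ) (r : ℕ) :
    (Finset.univ.filter fun i : ExpSet n => i.deg ≤ r).card ≤
      Module.finrank L (rankRM n θ r) := by
  classical
  have : Module.Finite L (SkewGalAlgebra K L) :=
    Module.Finite.of_basis (SkewMonoidAlgebra.basisSingleOne (k := L) (G := Gal(L/K)))
  have hmem : ∀ i : {i : ExpSet n // i.deg ≤ r},
      SkewMonoidAlgebra.single (thetaPow θ i.1) (1 : L) ∈ rankRM n θ r := by
    intro i j hj
    rw [SkewMonoidAlgebra.coeff_single_apply] at hj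
    have hij : thetaPow θ i.1 = thetaPow θ j := by
      by_contra hne
      exact hj (if_neg hne)
    exact h.bijective.1 hij ▸ i.2
  have hli : LinearIndependent L fun i : {i : ExpSet n // i.deg ≤ r} =>
      (⟨_, hmem i⟩ : rankRM n θ r) := by
    refine LinearIndependent.of_comp (rankRM n θ r).subtype ?_
    have := (SkewMonoidAlgebra.basisSingleOne (k := L) (G := Gal(L/K))).linearIndependent.comp
      (fun i : {i : ExpSet n // i.deg ≤ r} => thetaPow θ i.1)
      fun i j hij => Subtype.ext (h.bijective.1 hij)
    convert this using 1
    funext i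
    refine (SkewMonoidAlgebra.basisSingleOne (k := L) (G := Gal(L/K))).repr.injective ?_
    rw [Function.comp_apply, Function.comp_apply, Module.Basis.repr_self]
    rfl
  have := hli.fintype_card_le_finrank
  rwa [Fintype.card_subtype] at this

end Code

/-! ### An upper bound on the minimum distance -/

section MinimumDistance

open SkewGalAlgebra

variable {K : Type u} {L : Type v} [Field K] [Field L] [Algebra K L]
  {m : ℕ} {n : Fin m → ℕ} {θ : Fin m → Gal(L/K)}

/-- A nonzero `σ`-polynomial of degree at most `a` that vanishes at `a` given elements. -/
lemma exists_annihilating_coeff {L : Type v} [Field L] {N : ℕ} (a : Fin N)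
    (σ : Fin N → L → L) (x : Fin N → L) :
    ∃ p : Fin N → L, (∀ i, a < i → p i = 0) ∧ p ≠ 0 ∧
      ∀ l, l < a → ∑ i, p i * σ i (x l) = 0 := by
  classical
  let f : ({i // i ≤ a} → L) →ₗ[L] ({l // l < a} → L) :=
    LinearMap.pi fun l => ∑ i, (σ i.1 (x l.1)) • LinearMap.proj i
  -- There are `a + 1` unknown coefficients and only `a` linear conditions.
  have hf : LinearMap.ker f ≠ ⊥ := by
    apply LinearMap.ker_ne_bot_of_finrank_lt
    rw [Module.finrank_fintype_fun_eq_card, Module.finrank_fintype_fun_eq_card]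
    refine Fintype.card_lt_of_injective_of_notMem (fun l => ⟨l.1, l.2.le⟩) ?_ (b := ⟨a, le_rfl⟩) ?_
    · intro l l' hll
      exact Subtype.ext (congrArg (fun y : {i // i ≤ a} => y.1) hll)
    · rintro ⟨l, hl⟩
      exact l.2.ne (congrArg Subtype.val hl)
  obtain ⟨q, hq, hq0⟩ := Submodule.exists_mem_ne_zero_of_ne_bot hf
  refine ⟨fun i => if hi : i ≤ a then q ⟨i, hi⟩ else 0, fun i hi => dif_neg hi.not_ge, ?_, ?_⟩
  · intro h0
    apply hq0
    funext i
    have := congrFun h0 i.1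
    simpa [i.2] using this
  · intro l hl
    have h1 := congrFun (LinearMap.mem_ker.1 hq) ⟨l, hl⟩
    simp only [f, LinearMap.pi_apply, LinearMap.sum_apply, LinearMap.smul_apply,
      LinearMap.proj_apply, smul_eq_mul, Pi.zero_apply] at h1
    refine Eq.trans ?_ h1
    rw [Finset.sum_congr rfl fun (i : Fin N) _ => show _ = if i ≤ a then
      (if hi : i ≤ a then q ⟨i, hi⟩ else 0) * σ i (x l) else 0 by
        by_cases hi : i ≤ a <;> simp [hi],
      ← Finset.sum_filter, Finset.sum_subtype (p := fun i => i ≤ a) _ (by simp)]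
    refine Finset.sum_congr rfl fun i _ => ?_
    rw [dif_pos i.2, mul_comm]

/-- The subgroup generated by all `θ_k` with `k ≠ j`. -/
def coSubgroup [IsMulCommutative Gal(L/K)] (θ : Fin m → Gal(L/K)) (j : Fin m) :
    Subgroup Gal(L/K) where
  carrier := {g | ∃ a : Fin m → ℤ, a j = 0 ∧ thetaZPow θ a = g}
  one_mem' := ⟨0, rfl, thetaZPow_zero θ⟩
  mul_mem' := by
    rintro _ _ ⟨a, ha, rfl⟩ ⟨b, hb, rfl⟩
    exact ⟨a + b, by simp [ha, hb], thetaZPow_add θ a b⟩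
  inv_mem' := by
    rintro _ ⟨a, ha, rfl⟩
    exact ⟨-a, by simp [ha], thetaZPow_neg θ a⟩

/-- The fixed field of all `θ_k` with `k ≠ j`. -/
noncomputable def factorField [IsMulCommutative Gal(L/K)] (θ : Fin m → Gal(L/K)) (j : Fin m) :
    IntermediateField K L :=
  IntermediateField.fixedField (coSubgroup θ j)

variable [IsMulCommutative Gal(L/K)]

lemma thetaZPow_apply_factorField (θ : Fin m → Gal(L/K)) (j : Fin m) {x : L}
    (hx : x ∈ factorField θ j) (a : Fin m → ℤ) : thetaZPow θ a x = (θ j ^ a j) x := by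
  have h1 : thetaZPow θ a = θ j ^ a j * thetaZPow θ (a - Pi.single j (a j)) := by
    rw [← thetaZPow_single, ← thetaZPow_add]
    congr 1
    abel
  rw [h1, AlgEquiv.mul_apply]
  congr 1
  rw [factorField, IntermediateField.mem_fixedField_iff] at hx
  exact hx _ ⟨_, by simp, rfl⟩

variable [FiniteDimensional K L]

/-- The powers `θ_j ^ i` with `i < n j` meet every coset of the subgroup fixing this field, so its
index is at most `n j`. -/
lemma IsCyclicDecomposition.finrank_factorField_le [IsGalois K L]
    (h : IsCyclicDecomposition n θ) (j : Fin m) :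
    Module.finrank K (factorField θ j) ≤ n j := by
  have h1 := Module.finrank_mul_finrank K (factorField θ j) L
  rw [factorField, IntermediateField.finrank_fixedField_eq_card,
    ← IsGalois.card_aut_eq_finrank K L] at h1
  have h2 : Nat.card Gal(L/K) ≤ Nat.card (Fin (n j) × coSubgroup θ j) := by
    refine Nat.card_le_card_of_surjective
      (fun p : Fin (n j) × coSubgroup θ j => θ j ^ (p.1 : ℕ) * (p.2 : Gal(L/K))) fun g => ?_
    obtain ⟨i, rfl⟩ := h.bijective.2 g
    refine ⟨(i j, ⟨thetaZPow θ ((fun k => ((i k : ℕ) : ℤ)) - Pi.single j ((i j : ℕ) : ℤ)),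
      _, by simp, rfl⟩), ?_⟩
    have : θ j ^ (i j : ℕ) = thetaZPow θ (Pi.single j ((i j : ℕ) : ℤ)) := by
      rw [thetaZPow_single, zpow_natCast]
    simp only [this]
    rw [← thetaZPow_add, thetaPow_eq_thetaZPow]
    congr 1
    abel
  rw [Nat.card_prod, Nat.card_fin, ← h1] at h2
  exact Nat.le_of_mul_le_mul_right h2 Nat.card_pos

/-- By the Galois correspondence, `θ^i` fixing the `j`-th field lies in the subgroup generated by
the other `θ_k`, which forces `n j ∣ i j`. If this holds for all `j`, then `θ^i = 1`. -/
lemma IsCyclicDecomposition.adjoin_factorField [IsGalois K L] (h : IsCyclicDecomposition n θ) :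
    Algebra.adjoin K (⋃ j, (factorField θ j : Set L)) = ⊤ := by
  have h1 : IntermediateField.adjoin K (⋃ j, (factorField θ j : Set L)) = ⊤ := by
    rw [← IsGalois.fixedField_fixingSubgroup (IntermediateField.adjoin K _),
      ← IntermediateField.fixedField_bot]
    congr 1
    rw [eq_bot_iff]
    intro g hg
    obtain ⟨i, rfl⟩ := h.bijective.2 g
    rw [IntermediateField.mem_fixingSubgroup_iff] at hg
    have hi : ∀ j, (n j : ℤ) ∣ ((i j : ℕ) : ℤ) := by
      intro j
      have hmem : thetaPow θ i ∈ (factorField θ j).fixingSubgroup := by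
        rw [IntermediateField.mem_fixingSubgroup_iff]
        exact fun x hx => hg x (IntermediateField.subset_adjoin K _ (Set.mem_iUnion.2 ⟨j, hx⟩))
      rw [factorField, IntermediateField.fixingSubgroup_fixedField] at hmem
      obtain ⟨a, ha, hai⟩ := hmem
      rw [thetaPow_eq_thetaZPow, eq_comm, h.thetaZPow_eq_iff] at hai
      simpa [ha] using hai j
    rw [Subgroup.mem_bot, thetaPow_eq_thetaZPow, ← thetaZPow_zero θ, h.thetaZPow_eq_iff]
    simpa using hi
  rw [← IntermediateField.adjoin_toSubalgebra, h1, IntermediateField.top_toSubalgebra]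

/-- Products of spanning families of the factor fields span `L`. -/
lemma IsCyclicDecomposition.span_prod_eq_top [IsGalois K L] (h : IsCyclicDecomposition n θ)
    (x : ∀ j, Fin (n j) → L)
    (hx : ∀ j, (factorField θ j).toSubalgebra.toSubmodule ≤ Submodule.span K (Set.range (x j))) :
    Submodule.span K (Set.range fun l : ExpSet n => ∏ j, x j (l j)) = ⊤ := by
  classical
  rw [eq_top_iff, ← Algebra.top_toSubmodule, ← h.adjoin_factorField, Algebra.adjoin_eq_span,
    Submodule.span_le]
  intro z hz
  -- Collecting the factors from the same field turns any product of generators into one with a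
  -- single factor per `j`.
  have hz' : ∃ y : Fin m → L, (∀ j, y j ∈ factorField θ j) ∧ ∏ j, y j = z := by
    induction hz using Submonoid.closure_induction with
    | mem z hz =>
      obtain ⟨j, hj⟩ := Set.mem_iUnion.1 hz
      refine ⟨Pi.mulSingle j z, fun k => ?_, by simp⟩
      by_cases hk : k = j
      · subst hk; simpa using hj
      · rw [Pi.mulSingle_eq_of_ne hk]; exact one_mem _
    | one => exact ⟨1, fun j => one_mem _, by simp⟩
    | mul z z' _ _ hz hz' =>
      obtain ⟨y, hy, rfl⟩ := hz
      obtain ⟨y', hy', rfl⟩ := hz'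
      exact ⟨y * y', fun j => mul_mem (hy j) (hy' j), by simp [Finset.prod_mul_distrib]⟩
  obtain ⟨y, hy, rfl⟩ := hz'
  have hc : ∀ j, ∃ c : Fin (n j) → K, ∑ l, c l • x j l = y j := fun j =>
    (Submodule.mem_span_range_iff_exists_fun K).1 (hx j (hy j))
  choose c hc using hc
  simp only [← hc, Finset.prod_univ_sum, Finset.prod_smul]
  exact Submodule.sum_mem _ fun l _ => Submodule.smul_mem _ _ (Submodule.subset_span ⟨l, rfl⟩)

lemma card_filter_le_card_expBox (w : ExpSet n) :
    (Finset.univ.filter fun l : ExpSet n => ∀ j, w j ≤ l j).card ≤ (expBox w).card := by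
  refine Finset.card_le_card_of_injOn (fun l j => (l j).rev) (fun l hl => ?_) ?_
  · have hl' := (Finset.mem_filter.1 hl).2
    refine mem_expBox.2 fun j => ?_
    have h1 := Fin.le_def.1 (hl' j)
    have h2 := (l j).2
    rw [Fin.val_rev]
    omega
  · intro l _ l' _ hll
    funext j
    exact Fin.rev_injective (congrFun hll j)

/-- For every admissible `w`, there is a codeword of rank at most the size of the box of `w`. -/
lemma IsCyclicDecomposition.minRankDist_le [IsGalois K L] (h : IsCyclicDecomposition n θ) {r : ℕ}
    {w : ExpSet n} (hw : w.deg ≤ r) : minRankDist (rankRM n θ r) ≤ (expBox w).card := by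
  classical
  -- A basis padded by zeros to length `n j`, so that only the upper bound on the degree of the
  -- field is needed.
  let x : ∀ j, Fin (n j) → L := fun j l =>
    if hl : (l : ℕ) < Module.finrank K (factorField θ j) then
      (Module.finBasis K (factorField θ j) ⟨l, hl⟩ : L) else 0
  have hxmem : ∀ j l, x j l ∈ factorField θ j := by
    intro j l
    simp only [x]
    split_ifs
    · exact SetLike.coe_mem _
    · exact zero_mem _
  have hxspan : ∀ j, (factorField θ j).toSubalgebra.toSubmodule ≤
      Submodule.span K (Set.range (x j)) := by
    intro j y hy
    have hsum := (Module.finBasis K (factorField θ j)).sum_repr ⟨y, hy⟩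
    have hy' := congrArg (factorField θ j).val hsum
    rw [map_sum] at hy'
    change _ = y at hy'
    rw [← hy']
    refine Submodule.sum_mem _ fun i _ => ?_
    rw [map_smul]
    refine Submodule.smul_mem _ _ (Submodule.subset_span
      ⟨⟨i, i.2.trans_le (h.finrank_factorField_le j)⟩, ?_⟩)
    simp [x]
  choose p hp0 hpne hpsum using fun j =>
    exists_annihilating_coeff (w j) (fun a y => (θ j ^ (a : ℕ)) y) (x j)
  let e : ExpSet n ≃ Gal(L/K) := Equiv.ofBijective _ h.bijective
  let A : SkewGalAlgebra K L := ⟨Finsupp.equivFunOnFinite.symm fun g => ∏ j, p j (e.symm g j)⟩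
  have hA : ∀ i : ExpSet n, A.coeff (thetaPow θ i) = ∏ j, p j (i j) := by
    intro i
    change ∏ j, p j (e.symm (e i) j) = _
    rw [e.symm_apply_apply]
  have hAmem : A ∈ rankRM n θ r := by
    intro i hi
    rw [hA, Finset.prod_ne_zero_iff] at hi
    refine le_trans (Finset.sum_le_sum fun j _ => ?_) hw
    by_contra hlt
    exact hi j (Finset.mem_univ j) (hp0 j (i j) (Fin.lt_def.2 (not_le.1 hlt)))
  have hAne : A ≠ 0 := by
    choose a ha using fun j => Function.ne_iff.1 (hpne j)
    intro h0
    have h1 := hA a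
    rw [h0, SkewMonoidAlgebra.coeff_zero, Finsupp.zero_apply, eq_comm,
      Finset.prod_eq_zero_iff] at h1
    obtain ⟨j, _, hj⟩ := h1
    exact ha j hj
  -- Every other `θ_k` fixes the `j`-th field, so `A` acts factor by factor, and one vanishing
  -- factor suffices.
  have hval : ∀ l : ExpSet n, toEnd A (∏ j, x j (l j)) =
      ∏ j, ∑ a, p j a * (θ j ^ (a : ℕ)) (x j (l j)) := by
    intro l
    rw [toEnd_apply, ← Equiv.sum_comp e, Finset.prod_univ_sum, Fintype.piFinset_univ]
    refine Finset.sum_congr rfl fun i _ => ?_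
    change A.coeff (thetaPow θ i) * thetaPow θ i _ = _
    rw [hA, map_prod, Finset.prod_mul_distrib]
    congr 1
    refine Finset.prod_congr rfl fun j _ => ?_
    rw [thetaPow_eq_thetaZPow, thetaZPow_apply_factorField θ j (hxmem j _), zpow_natCast]
  have hrk : rk A ≤ (expBox w).card := by
    refine le_trans ?_ (card_filter_le_card_expBox w)
    let S := Finset.univ.filter fun l : ExpSet n => ∀ j, w j ≤ l j
    have hle : LinearMap.range (toEnd A) ≤
        Submodule.span K (Set.range fun l : S => toEnd A (∏ j, x j (l.1 j))) := by
      rw [LinearMap.range_eq_map, ← h.span_prod_eq_top x hxspan, Submodule.map_span,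
        Submodule.span_le]
      rintro _ ⟨_, ⟨l, rfl⟩, rfl⟩
      by_cases hl : ∀ j, w j ≤ l j
      · exact Submodule.subset_span ⟨⟨l, by simp [S, hl]⟩, rfl⟩
      · obtain ⟨j, hj⟩ := not_forall.1 hl
        have : toEnd A (∏ j, x j (l j)) = 0 := by
          rw [hval]
          exact Finset.prod_eq_zero (Finset.mem_univ j) (hpsum j (l j) (not_le.1 hj))
        rw [SetLike.mem_coe, this]
        exact zero_mem _
    refine (Submodule.finrank_mono hle).trans ((finrank_range_le_card _).trans ?_)
    rw [Fintype.card_coe]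
  exact le_trans (b := rk A) (Nat.sInf_le ⟨A, hAmem, hAne, rfl⟩) hrk

/-- The minimum distance is attained at a nonzero codeword, hence positive. -/
lemma minRankDist_rankRM_pos (h : IsCyclicDecomposition n θ) (r : ℕ) :
    0 < minRankDist (rankRM n θ r) := by
  have hone : (1 : SkewGalAlgebra K L) ∈ rankRM n θ r := by
    intro i hi
    have hi0 : i = h.reduce 0 := by
      apply h.bijective.1
      rw [h.thetaPow_reduce, thetaZPow_zero]
      by_contra hne
      apply hi
      rw [SkewMonoidAlgebra.coeff_one, Finsupp.single_eq_of_ne hne]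
    subst hi0
    simp [ExpSet.deg, IsCyclicDecomposition.reduce]
  obtain ⟨A, -, hA, hrk⟩ := Nat.sInf_mem (s := {s | ∃ A ∈ rankRM n θ r, A ≠ 0 ∧ rk A = s})
    ⟨_, 1, hone, one_ne_zero, rfl⟩
  rw [minRankDist, ← hrk]
  exact Nat.pos_of_ne_zero fun h0 => hA (rk_eq_zero_iff.1 h0)

/-- Unique decoding up to half the minimum distance. -/
lemma eq_of_rk_le (h : IsCyclicDecomposition n θ) {r t : ℕ}
    (ht : t = (minRankDist (rankRM n θ r) - 1) / 2) {C C' E : SkewGalAlgebra K L}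
    (hC : C ∈ rankRM n θ r) (hC' : C' ∈ rankRM n θ r) (hE : rk E ≤ t)
    (hE' : rk (C + E - C') ≤ t) : C' = C := by
  by_contra hne
  have h1 : minRankDist (rankRM n θ r) ≤ rk (C - C') :=
    Nat.sInf_le ⟨_, Submodule.sub_mem _ hC hC', sub_ne_zero.2 (Ne.symm hne), rfl⟩
  have h2 := rk_sub_le (C + E - C') E
  rw [show C + E - C' - E = C - C' by abel] at h2
  have := minRankDist_rankRM_pos h r
  omega

end MinimumDistance

/-! ### Decoding -/

section Decoding

open SkewGalAlgebra

variable {K : Type u} {L : Type v} [Field K] [Field L] [Algebra K L] {m : ℕ} {n : Fin m → ℕ}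
  {θ : Fin m → Gal(L/K)} {r t : ℕ}

lemma exists_colex_chain {w : ExpSet n} {k : ℕ} (hk : k ≤ (expBox w).card) :
    ∃ σ : Fin k → ExpSet n, (∀ p q, p < q → toColex (σ p) < toColex (σ q)) ∧
      ∀ p, σ p ∈ expBox w := by
  classical
  have hk' : k ≤ ((expBox w).map (toColex (α := ExpSet n)).toEmbedding).card := by
    rwa [Finset.card_map]
  refine ⟨fun p => ofColex (Finset.orderEmbOfCardLe _ hk' p), fun p q hpq => ?_, fun p => ?_⟩
  · exact (Finset.orderEmbOfCardLe _ hk').strictMono hpq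
  · obtain ⟨s, hs, hsp⟩ := Finset.mem_map.1 (Finset.orderEmbOfCardLe_mem _ hk' p)
    change ofColex (Finset.orderEmbOfCardLe _ hk' p) ∈ expBox w
    rw [← hsp]
    exact hs

variable [FiniteDimensional K L]

lemma IsCyclicDecomposition.det_submatrix_dicksonMatrix_eq_zero (h : IsCyclicDecomposition n θ)
    {E : SkewGalAlgebra K L} (hE : rk E ≤ t) (I J : Fin (t + 1) → ExpSet n) :
    ((dicksonMatrix θ E).submatrix I J).det = 0 := by
  by_contra hdet
  have h1 := Matrix.rank_of_det_ne_zero hdet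
  have h2 := Matrix.rank_submatrix_le (dicksonMatrix θ E) I J
  have h3 := h.rank_dicksonMatrix_le E
  rw [Fintype.card_fin] at h1
  omega

variable [IsAbelianGalois K L]

/-- Since `d > 0`, the choice of `t` gives `2 * t + 1 ≤ d`, and the box has at least `d` elements.
-/
lemma IsCyclicDecomposition.exists_chain (h : IsCyclicDecomposition n θ)
    (ht : t = (minRankDist (rankRM n θ r) - 1) / 2) {w : ExpSet n} (hw : w.deg ≤ r) :
    ∃ σ : Fin (2 * t + 1) → ExpSet n, (∀ p q, p < q → toColex (σ p) < toColex (σ q)) ∧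
      ∀ p, σ p ∈ expBox w := by
  refine exists_colex_chain (le_trans ?_ (h.minRankDist_le hw))
  have := minRankDist_rankRM_pos h r
  omega

/-- Vanishing minors of the Dickson matrix with exactly one unknown entry. -/
lemma IsCyclicDecomposition.exists_minor (h : IsCyclicDecomposition n θ)
    (ht : t = (minRankDist (rankRM n θ r) - 1) / 2) {w : ExpSet n} (hw : w.deg ≤ r) :
    ∃ (I J : Fin (t + 1) ↪ ExpSet n) (a b : Fin (t + 1)),
      thetaPow θ (J b) * thetaPow θ w = thetaPow θ (I a) ∧
      (∀ (a' b' : Fin (t + 1)) (i : ExpSet n), (a', b') ≠ (a, b) →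
        thetaPow θ (J b') * thetaPow θ i = thetaPow θ (I a') →
        r < i.deg ∨ toColex w < toColex i) ∧
      ∀ E : SkewGalAlgebra K L, rk E ≤ t →
        ((dicksonMatrix θ E).submatrix I J).det = 0 := by
  obtain ⟨σ, hσ, hbox⟩ := h.exists_chain ht hw
  have hσinj : Function.Injective σ := by
    intro p q hpq
    rcases lt_trichotomy p q with hlt | heq | hlt
    · exact absurd (congrArg toColex hpq) (hσ p q hlt).ne
    · exact heq
    · exact absurd (congrArg toColex hpq) (hσ q p hlt).ne'
  -- Rows `t, …, 2 * t` against columns `0, …, t`: all positions lie strictly below the diagonal of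
  -- the chain matrix except the corner `(t, t)`.
  let row : Fin (t + 1) → Fin (2 * t + 1) := fun a => ⟨t + a, by omega⟩
  let col : Fin (t + 1) → Fin (2 * t + 1) := fun b => ⟨b, by omega⟩
  have hrow : Function.Injective row := fun a a' e => by
    have := congrArg Fin.val e
    exact Fin.ext (by simpa [row] using this)
  have hcol : Function.Injective col := fun a a' e => by
    have := congrArg Fin.val e
    exact Fin.ext (by simpa [col] using this)
  refine ⟨⟨fun a => expAdd w (σ (row a)) (hbox _), fun a a' e =>
      hrow (hσinj (expAdd_injective _ _ e))⟩, ⟨fun b => σ (col b), hσinj.comp hcol⟩, 0, Fin.last t,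
    ?_, fun a b i hab hi => Or.inr ?_, fun E hE => h.det_submatrix_dicksonMatrix_eq_zero hE _ _⟩
  · have : row 0 = col (Fin.last t) := Fin.ext (by simp [row, col])
    change thetaPow θ (σ (col (Fin.last t))) * _ = thetaPow θ (expAdd w (σ (row 0)) (hbox _))
    rw [thetaPow_expAdd, this]
  · refine h.lt_of_mul_eq_expAdd (hbox (row a)) (hσ (col b) (row a) ?_) hi
    rw [Fin.lt_def]
    have hb := b.2
    by_contra hlt
    apply hab
    simp only [row, col] at hlt
    exact Prod.ext (Fin.ext (show (a : ℕ) = 0 by omega)) (Fin.ext (show (b : ℕ) = t by omega))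

/-- Each unknown coefficient of an error of small rank can be computed from those before it. -/
lemma IsCyclicDecomposition.exists_coeff_recovery (h : IsCyclicDecomposition n θ)
    (ht : t = (minRankDist (rankRM n θ r) - 1) / 2) {c ω : ℝ} (hc : LinAlgExponent L c ω)
    (hω : 2 ≤ ω) {w : ExpSet n} (hw : w.deg ≤ r) :
    ∃ f : ({i : ExpSet n // r < i.deg ∨ toColex w < toColex i} → L) → Unit → L,
      TreeComputable (fun (g : Gal(L/K)) x => g x) (recoveryConst c ω * ((t : ℝ) + 1) ^ ω) f ∧
      ∀ E : SkewGalAlgebra K L, rk E ≤ t →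
        f (fun i => thetaCoeff θ E i.1) () = thetaCoeff θ E w := by
  obtain ⟨σ, hσ, hbox⟩ := h.exists_chain ht hw
  have hex : ∀ p q, ∃ i : ExpSet n,
      thetaPow θ (σ q) * thetaPow θ i = thetaPow θ (expAdd w (σ p) (hbox p)) := by
    intro p q
    obtain ⟨i, hi⟩ := h.bijective.2 ((thetaPow θ (σ q))⁻¹ * thetaPow θ (expAdd w (σ p) (hbox p)))
    exact ⟨i, by rw [hi, mul_inv_cancel_left]⟩
  choose idx hidx using hex
  obtain ⟨f, hf, hfE⟩ := exists_recovery (act := fun (g : Gal(L/K)) x => g x) hc hω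
    (rfl : 2 * t + 1 = 2 * t + 1)
    (V := {i : ExpSet n // r < i.deg ∨ toColex w < toColex i})
    (fun p q hpq => ⟨idx p q, Or.inr (h.lt_of_mul_eq_expAdd (hbox p) (hσ q p hpq) (hidx p q))⟩)
    (fun q => thetaPow θ (σ q)) (fun q => (thetaPow θ (σ q))⁻¹)
    (fun q x => (thetaPow θ (σ q)).symm_apply_apply x)
  refine ⟨f, hf, fun E hE => hfE _ _ ((dicksonMatrix θ E).submatrix
    (fun p => expAdd w (σ p) (hbox p)) σ) ?_ ?_ ?_⟩
  · exact (Matrix.rank_submatrix_le _ _ _).trans ((h.rank_dicksonMatrix_le E).trans hE)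
  · intro p q hpq
    simp only [Matrix.submatrix_apply, dicksonMatrix, Matrix.of_apply, thetaCoeff]
    rw [← hidx p q, inv_mul_cancel_left]
  · intro p
    simp only [Matrix.submatrix_apply, dicksonMatrix, Matrix.of_apply, thetaCoeff]
    rw [thetaPow_expAdd, inv_mul_cancel_left]

/-- The coefficients in an upper set of unknown exponents can be recovered one after another. -/
lemma IsCyclicDecomposition.exists_error_recovery (h : IsCyclicDecomposition n θ)
    (ht : t = (minRankDist (rankRM n θ r) - 1) / 2) {c ω : ℝ} (hc : LinAlgExponent L c ω)
    (hω : 2 ≤ ω) (S : Finset (Colex (ExpSet n)))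
    (hS : ∀ i ∈ S, (ofColex i).deg ≤ r)
    (hup : ∀ i ∈ S, ∀ j, i < j → (ofColex j).deg ≤ r → j ∈ S) :
    ∃ f : (ExpSet n → L) → ExpSet n → L,
      TreeComputable (fun (g : Gal(L/K)) x => g x)
        (S.card * (recoveryConst c ω * ((t : ℝ) + 1) ^ ω)) f ∧
      ∀ C ∈ rankRM n θ r, ∀ E : SkewGalAlgebra K L, rk E ≤ t → ∀ i : ExpSet n,
        (r < i.deg ∨ toColex i ∈ S) → f (thetaCoeff θ (C + E)) i = thetaCoeff θ E i := by
  classical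
  -- Adding the minimum of an upper set is what makes the coefficients needed for `w` available.
  -- Initially these are the coefficients of degree above `r`, to which `C` does not contribute;
  -- outputs outside the known set carry no meaning.
  induction S using Finset.induction_on_min with
  | empty =>
    refine ⟨fun x i => x i, by simpa using TreeComputable.select id, fun C hC E _ i hi => ?_⟩
    have hi' : r < i.deg := by simpa using hi
    have : C.coeff (thetaPow θ i) = 0 := by
      by_contra hne
      exact absurd (hC i hne) (not_le.2 hi')
    simp [thetaCoeff, this]
  | insert w S hwS ih =>
    obtain ⟨f, hf, hfE⟩ := ih (fun i hi => hS i (Finset.mem_insert_of_mem hi))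
      (fun i hi j hij hj => (Finset.mem_insert.1
        (hup i (Finset.mem_insert_of_mem hi) j hij hj)).resolve_left
          fun e => absurd (hwS i hi) (not_lt.2 (e ▸ hij.le)))
    obtain ⟨g, hg, hgE⟩ := h.exists_coeff_recovery ht hc hω
      (hS w (Finset.mem_insert_self w S))
    have hw : w ∉ S := fun hmem => lt_irrefl w (hwS w hmem)
    have hstep := hf.comp ((TreeComputable.select (act := fun (g : Gal(L/K)) x => g x) (F := L)
      (id : ExpSet n → ExpSet n)).pair (hg.precomp Subtype.val))
    have hfin := hstep.postcomp fun i : ExpSet n =>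
      if i = ofColex w then Sum.inr () else Sum.inl i
    refine ⟨_, hfin.mono (le_of_eq ?_), fun C hC E hE i hi => ?_⟩
    · rw [Finset.card_insert_of_notMem hw]
      push_cast
      ring
    · by_cases hiw : i = ofColex w
      · simp only [if_pos hiw, Sum.elim_inr]
        rw [hiw, ← hgE E hE]
        congr 1
        funext j
        refine hfE C hC E hE j.1 ?_
        rcases j.2 with hj | hj
        · exact Or.inl hj
        · by_cases hjr : r < j.1.deg
          · exact Or.inl hjr
          · refine Or.inr ((Finset.mem_insert.1 (hup w (Finset.mem_insert_self w S)
              (toColex j.1) hj (not_lt.1 hjr))).resolve_left fun e => ?_)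
            exact absurd hj (by rw [e]; exact lt_irrefl w)
      · simp only [if_neg hiw, Sum.elim_inl]
        refine hfE C hC E hE i (hi.imp_right fun hmem => (Finset.mem_insert.1 hmem).resolve_left ?_)
        exact fun e => hiw (by rw [← e]; rfl)

/-- The codeword can be computed from the received word. -/
lemma IsCyclicDecomposition.exists_decoder (h : IsCyclicDecomposition n θ)
    (ht : t = (minRankDist (rankRM n θ r) - 1) / 2) {c ω : ℝ} (hc : LinAlgExponent L c ω)
    (hω : 2 ≤ ω) :
    ∃ f : (ExpSet n → L) → ExpSet n → L,
      TreeComputable (fun (g : Gal(L/K)) x => g x)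
        (Module.finrank L (rankRM n θ r) * ((recoveryConst c ω + 2) * 2 ^ ω) * (t : ℝ) ^ ω) f ∧
      ∀ C ∈ rankRM n θ r, ∀ E : SkewGalAlgebra K L, rk E ≤ t →
        f (thetaCoeff θ (C + E)) = thetaCoeff θ C := by
  classical
  have hω0 : ω ≠ 0 := by linarith
  -- For `t = 0` the bound allows no operation at all, but then `E = 0` and the input is returned.
  -- For `t ≥ 1`, `t + 1 ≤ 2 * t` gives the factor `2 ^ ω`.
  rcases Nat.eq_zero_or_pos t with ht0 | htpos
  · subst ht0
    refine ⟨fun x i => x i, (TreeComputable.select id).mono ?_, fun C _ E hE => ?_⟩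
    · simp [Real.zero_rpow hω0]
    · rw [rk_eq_zero_iff.1 (Nat.le_zero.1 hE), add_zero]
  · let S : Finset (Colex (ExpSet n)) := (Finset.univ.filter fun i : ExpSet n => i.deg ≤ r).map
      (toColex (α := ExpSet n)).toEmbedding
    have hmem : ∀ i, i ∈ S ↔ (ofColex i).deg ≤ r := by
      intro i
      simp [S]
    obtain ⟨f, hf, hfE⟩ := h.exists_error_recovery ht hc hω S (fun i hi => (hmem i).1 hi)
      (fun _ _ j _ hj => (hmem j).2 hj)
    have hsub := (hf.postcomp (Subtype.val : {i : ExpSet n // i.deg ≤ r} → ExpSet n))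
    have hdiff := (TreeComputable.select (act := fun (g : Gal(L/K)) x => g x) (F := L)
      (Subtype.val : {i : ExpSet n // i.deg ≤ r} → ExpSet n)).sub hsub
    -- A single zero serves all coefficients of degree above `r`, so the cost does not depend on the
    -- order of the group. The subtractions and this zero are the `+ 2` in the constant.
    have hall := (hdiff.pair (TreeComputable.op (act := fun (g : Gal(L/K)) x => g x) (F := L)
      (O := Unit) (V := ExpSet n) .zero)).postcomp fun i : ExpSet n =>
        if hi : i.deg ≤ r then Sum.inl ⟨i, hi⟩ else Sum.inr ()
    refine ⟨_, hall.mono ?_, fun C hC E hE => ?_⟩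
    · have hcard := h.card_le_finrank_rankRM r
      have hpos : 0 < (Finset.univ.filter fun i : ExpSet n => i.deg ≤ r).card :=
        Finset.card_pos.2 ⟨h.reduce 0, Finset.mem_filter.2 ⟨Finset.mem_univ _, by
          simp [ExpSet.deg, IsCyclicDecomposition.reduce]⟩⟩
      rw [Finset.card_map, Fintype.card_subtype]
      set k' := (Finset.univ.filter fun i : ExpSet n => i.deg ≤ r).card
      set k := Module.finrank L (rankRM n θ r)
      have hk : (k' : ℝ) ≤ k := by exact_mod_cast hcard
      have hk1 : (1 : ℝ) ≤ k := by exact_mod_cast hpos.trans_le hcard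
      have ht1 : (1 : ℝ) ≤ t := by exact_mod_cast htpos
      have h2 : ((t : ℝ) + 1) ^ ω ≤ 2 ^ ω * (t : ℝ) ^ ω := by
        rw [← Real.mul_rpow (by norm_num) (by linarith)]
        exact Real.rpow_le_rpow (by linarith) (by linarith) (by linarith)
      have h1 : (1 : ℝ) ≤ ((t : ℝ) + 1) ^ ω := Real.one_le_rpow (by linarith) (by linarith)
      have hR : 0 ≤ recoveryConst c ω := by rw [recoveryConst]; positivity
      have h3 : (k' : ℝ) * (recoveryConst c ω * ((t : ℝ) + 1) ^ ω) ≤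
          k * (recoveryConst c ω * (2 ^ ω * (t : ℝ) ^ ω)) := by gcongr
      have h4 : (k : ℝ) * 1 ≤ k * (2 ^ ω * (t : ℝ) ^ ω) :=
        mul_le_mul_of_nonneg_left (h1.trans h2) (by linarith)
      linarith
    · funext i
      by_cases hi : i.deg ≤ r
      · simp only [dif_pos hi, Sum.elim_inl]
        rw [hfE C hC E hE i (Or.inr ((hmem _).2 hi))]
        simp [thetaCoeff]
      · simp only [dif_neg hi, Sum.elim_inr, ArithOp.eval]
        symm
        by_contra hne
        exact hi (hC i hne)

end Decoding

theorem mainTheorem1 (ω : ℝ) (hω : 2 ≤ ω) (c₀ : ℝ) :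
    ∃ c : ℝ, ∀ (K : Type u) (L : Type v) [Field K] [Field L] [Algebra K L]
      [FiniteDimensional K L] [IsAbelianGalois K L]
      (m : ℕ) (n : Fin m → ℕ) (θ : Fin m → Gal(L/K)) (_ : IsCyclicDecomposition n θ)
      (r d t k : ℕ) (_ : d = minRankDist (rankRM n θ r)) (_ : t = (d - 1) / 2)
      (_ : k = Module.finrank L (rankRM n θ r)),
      -- unique decoding
      (∀ C ∈ rankRM n θ r, ∀ E : SkewGalAlgebra K L, SkewGalAlgebra.rk E ≤ t →
        ∀ C' ∈ rankRM n θ r, SkewGalAlgebra.rk (C + E - C') ≤ t → C' = C) ∧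
      -- vanishing minors of the Dickson matrix with exactly one unknown entry
      (∀ w : ExpSet n, w.deg ≤ r →
        ∃ (I J : Fin (t + 1) ↪ ExpSet n) (a b : Fin (t + 1)),
          thetaPow θ (J b) * thetaPow θ w = thetaPow θ (I a) ∧
          (∀ (a' b' : Fin (t + 1)) (i : ExpSet n), (a', b') ≠ (a, b) →
            thetaPow θ (J b') * thetaPow θ i = thetaPow θ (I a') →
            r < i.deg ∨ toColex w < toColex i) ∧
          ∀ E : SkewGalAlgebra K L, SkewGalAlgebra.rk E ≤ t →
            ((dicksonMatrix θ E).submatrix I J).det = 0) ∧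
      -- the algorithms and their number of operations in `L`
      (LinAlgExponent L c₀ ω →
        -- each unknown coefficient of `E` from those known before it, in reverse lexicographic order
        (∀ w : ExpSet n, w.deg ≤ r →
          ∃ T : CompTree Gal(L/K) Unit {i : ExpSet n // r < i.deg ∨ toColex w < toColex i},
            ∀ E : SkewGalAlgebra K L, SkewGalAlgebra.rk E ≤ t →
              T.eval (fun g x => g x) (fun i => thetaCoeff θ E i.1) () = thetaCoeff θ E w ∧
              (T.cost (fun g x => g x) (fun i => thetaCoeff θ E i.1) : ℝ) ≤
                c * ((t : ℝ) + 1) ^ ω) ∧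
        -- the codeword from the received word
        ∃ T : CompTree Gal(L/K) (ExpSet n) (ExpSet n),
          ∀ C ∈ rankRM n θ r, ∀ E : SkewGalAlgebra K L, SkewGalAlgebra.rk E ≤ t →
            T.eval (fun g x => g x) (thetaCoeff θ (C + E)) = thetaCoeff θ C ∧
            (T.cost (fun g x => g x) (thetaCoeff θ (C + E)) : ℝ) ≤ c * k * (t : ℝ) ^ ω) := by
  refine ⟨(recoveryConst c₀ ω + 2) * 2 ^ ω, ?_⟩
  intro K L _ _ _ _ _ m n θ h r d t k hd ht hk
  subst hd hk
  refine ⟨fun C hC E hE C' hC' hE' => eq_of_rk_le h ht hC hC' hE hE',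
    fun w hw => h.exists_minor ht hw, fun hc => ⟨fun w hw => ?_, ?_⟩⟩
  · obtain ⟨f, ⟨T, hT⟩, hfE⟩ := h.exists_coeff_recovery ht hc hω hw
    refine ⟨T, fun E hE => ⟨by rw [(hT _).1, hfE E hE], (hT _).2.trans ?_⟩⟩
    have h1 : (1 : ℝ) ≤ 2 ^ ω := Real.one_le_rpow (by norm_num) (by linarith)
    have hR : 0 ≤ recoveryConst c₀ ω := by rw [recoveryConst]; positivity
    refine mul_le_mul_of_nonneg_right ?_ (by positivity)
    nlinarith
  · obtain ⟨f, ⟨T, hT⟩, hfE⟩ := h.exists_decoder ht hc hω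
    refine ⟨T, fun C hC E hE => ⟨by rw [(hT _).1, hfE C hC E hE], (hT _).2.trans (le_of_eq ?_)⟩⟩
    ring
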